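/- Let $\mathbb K$ be a field, let $a_1,\dots,a_n\ge 1$ be integers, and let $A=(x_{i_1,\dots,i_n})$, $1\le i_j\le a_j$, be the generic $a_1\times\cdots\times a_n$ table over $R=\mathbb K[x_{i_1,\dots,i_n}]$. For $\mathscr J\subseteq\{1,\dots,n\}$ let the margin $A_{\mathscr J}$ be the table indexed by the coordinates in $\mathscr J$ whose entries are obtained from $A$ by summing over all the coordinates not in $\mathscr J$, and let $L_{\mathscr J}\subseteq R$ be the ideal generated by the entries of $A_{\mathscr J}$. For a table $B=(b_i)$ with entries in $R$ let $I(B)\subseteq R$ be the ideal generated by the generalized $2\times 2$ minors $b_ib_j-b_{i'}b_{j'}$, where $i',j'$ arise from the multi-indices $i,j$ by interchanging their $l$-th coordinates, for some coordinate $l$. Let $\Delta$ be a simplicial complex on $\{1,\dots,n\}$ (a family of subsets closed under taking subsets; a facet is a maximal member, and not every $\{j\}$ need belong to $\Delta$). Put $I_\Delta=\sum_{\mathscr J\in\Delta}I(A_{\mathscr J})\subseteq R$. Let $S_\Delta$ be the polynomial ring over $\mathbb K$ with one variable for every entry of every margin $A_{\mathscr J}$, $\mathscr J\in\Delta$; let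 $\tau_\Delta\colon S_\Delta\to R$ send each variable to the corresponding entry; let $\sigma_\Delta\colon S_\Delta\to\mathbb K[y_{j,i}\mid 1\le j\le n,\ 1\le i\le a_j]$ be $\tau_\Delta$ followed by $x_{i_1,\dots,i_n}\mapsto\prod_j y_{j,i_j}$; and let $P_\Delta\subseteq R$ be the ideal generated by $\tau_\Delta(\ker\sigma_\Delta)$. Suppose that $\Delta$ has exactly two facets $\mathscr J_1\ne\mathscr J_2$. For $i_1\in\mathscr J_1\smallsetminus\mathscr J_2$ and $i_2\in\mathscr J_2\smallsetminus\mathscr J_1$ put $$Q_{i_1,i_2}=I_\Delta+L_{\mathscr J_1\smallsetminus\{i_1\}}+L_{\mathscr J_2\smallsetminus\{i_2\}}.$$ Then: 1. Every $Q_{i_1,i_2}$ is a prime ideal. 2. If $a_j\ge 2$ for all $j$ and $\mathscr J_1\cap\mathscr J_2\neq\emptyset$, then the minimal primes over $I_\Delta$ are exactly $P_\Delta$ and the ideals $Q_{i_1,i_2}$ with $i_1\in\mathscr J_1\smallsetminus\mathscr J_2$, $i_2\in\mathscr J_2\smallsetminus\mathscr J_1$. 3. In general (all $a_j\ge1$,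 $\mathscr J_1\cap\mathscr J_2$ possibly empty), the minimal primes over $I_\Delta$ are exactly $P_\Delta$ and those $Q_{i_1,i_2}$ for which $a_{i_1}\ge 2$, $a_{i_2}\ge 2$ and $a_c\ge 2$ for some $c\in\mathscr J_1\cap\mathscr J_2$. In particular $P_\Delta$ is the only minimal prime if $\mathscr J_1\cap\mathscr J_2=\emptyset$. -/

import Mathlib

noncomputable section

namespace MarginalIndependence

/-- Index set of an array whose coordinates are labelled by `J ⊆ {1, …, n}`; coordinate `j` takes
`a j` values. For `J = univ` this indexes (up to relabelling) the full table. -/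
abbrev Cell {n : ℕ} (a : Fin n → ℕ) (J : Finset (Fin n)) : Type :=
  (j : J) → Fin (a j)

/-- The polynomial ring `𝕂[x_{i₁,…,iₙ}]` in the entries of the generic `a₁ × ⋯ × aₙ` table. -/
abbrev TableRing (K : Type*) [Field K] {n : ℕ} (a : Fin n → ℕ) : Type _ :=
  MvPolynomial ((j : Fin n) → Fin (a j)) K

/-- The margin `A_J` of the generic table `A`: the entry at `s` is the sum of all the variables
`x_i` whose index `i` agrees with `s` on `J`. -/
def margin (K : Type*) [Field K] {n : ℕ} (a : Fin n → ℕ) (J : Finset (Fin n))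
    (s : Cell a J) : TableRing K a :=
  ∑ i : (j : Fin n) → Fin (a j) with ∀ j : J, i j = s j, MvPolynomial.X i

/-- The ideal generated by the generalized `2 × 2` minors of an array `B` with entries in a
commutative ring: for indices `i, j` and a coordinate `l`, the minor is
`B_i B_j - B_{j with l-th coordinate i_l} B_{i with l-th coordinate j_l}`. -/
def segreIdeal {R : Type*} [CommRing R] {ι : Type*} [DecidableEq ι] {β : ι → Type*}
    (B : ((j : ι) → β j) → R) : Ideal R :=
  Ideal.span {f | ∃ (l : ι) (i j : (j : ι) → β j),
    f = B i * B j - B (Function.update j l (i l)) * B (Function.update i l (j l))}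

/-- `I_Δ`: the sum of the ideals of `2 × 2` minors of the margins `A_J`, `J ∈ Δ`. -/
def independenceIdeal (K : Type*) [Field K] {n : ℕ} (a : Fin n → ℕ)
    (Δ : Set (Finset (Fin n))) : Ideal (TableRing K a) :=
  ⨆ J ∈ Δ, segreIdeal (margin K a J)

/-- `L_J`: the ideal generated by the entries of the margin `A_J`. -/
def marginIdeal (K : Type*) [Field K] {n : ℕ} (a : Fin n → ℕ) (J : Finset (Fin n)) :
    Ideal (TableRing K a) :=
  Ideal.span (Set.range (margin K a J))

/-- `S_Δ`: the polynomial ring with one variable for every entry of every margin `A_J`, `J ∈ Δ`. -/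
abbrev MarginRing (K : Type*) [Field K] {n : ℕ} (a : Fin n → ℕ)
    (Δ : Set (Finset (Fin n))) : Type _ :=
  MvPolynomial ((J : Δ) × Cell a J.1) K

/-- `τ_Δ : S_Δ → R`, sending each formal symbol to the corresponding entry of `A_J`. -/
def tau (K : Type*) [Field K] {n : ℕ} (a : Fin n → ℕ) (Δ : Set (Finset (Fin n))) :
    MarginRing K a Δ →ₐ[K] TableRing K a :=
  MvPolynomial.aeval fun p => margin K a p.1.1 p.2

/-- The Segre parametrization `x_{i₁,…,iₙ} ↦ ∏ j, y_{j,i_j}`. -/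
def segreMap (K : Type*) [Field K] {n : ℕ} (a : Fin n → ℕ) :
    TableRing K a →ₐ[K] MvPolynomial ((j : Fin n) × Fin (a j)) K :=
  MvPolynomial.aeval fun i => ∏ j, MvPolynomial.X ⟨j, i j⟩

/-- `σ_Δ : S_Δ → 𝕂[y_{j,i}]`, the composite of `τ_Δ` and the Segre parametrization. -/
def sigma (K : Type*) [Field K] {n : ℕ} (a : Fin n → ℕ) (Δ : Set (Finset (Fin n))) :
    MarginRing K a Δ →ₐ[K] MvPolynomial ((j : Fin n) × Fin (a j)) K :=
  (segreMap K a).comp (tau K a Δ)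

/-- `P_Δ` as an ideal of `R`: the ideal generated by the image under `τ_Δ` of `ker σ_Δ`. -/
def mainIdeal (K : Type*) [Field K] {n : ℕ} (a : Fin n → ℕ) (Δ : Set (Finset (Fin n))) :
    Ideal (TableRing K a) :=
  (RingHom.ker (sigma K a Δ)).map (tau K a Δ)

/-- The facets of `Δ`: its inclusion-maximal members. -/
def facets {n : ℕ} (Δ : Set (Finset (Fin n))) : Set (Finset (Fin n)) :=
  {J | Maximal (· ∈ Δ) J}

/-- The ideal `I_Δ + L_{J₁ ∖ i₁} + L_{J₂ ∖ i₂}`. -/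
def twoFacetIdeal (K : Type*) [Field K] {n : ℕ} (a : Fin n → ℕ) (Δ : Set (Finset (Fin n)))
    (J₁ J₂ : Finset (Fin n)) (i₁ i₂ : Fin n) : Ideal (TableRing K a) :=
  independenceIdeal K a Δ + marginIdeal K a (J₁.erase i₁) + marginIdeal K a (J₂.erase i₂)

end MarginalIndependence

end

/-! A prime `q` over `I_Δ` is the kernel of a map `φ` from `R` to the field `Frac(R/q)`, and `I_Δ ≤
q` says that the images of the two facet margins have rank at most one; smaller margins inherit this
by summation. So these images are product tables `∏ u_j` on `J₁` and `∏ v_j` on `J₂`, with the same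
margin on `J₁ ∩ J₂`.

If that margin is nonzero somewhere, `u` and `v` can be normalised to one family `w`
(`exists_common_family`). After rescaling, `w` extends to a rank-one full table with the right facet
margins, so `φ ∘ τ_Δ` factors through `σ_Δ` and `P_Δ ≤ q` (`eq_zero_of_mem_ker_sigma`). If it
vanishes, some `u_{i₁}` and `v_{i₂}`, in directions outside the intersection, can be taken to sum to
zero, which gives `Q_{i₁,i₂} ≤ q`. When the size conditions fail for this pair, the families can
still be merged, and a one-parameter deformation to the nonvanishing case again gives `P_Δ ≤ q`
(`eq_zero_of_mem_ker_sigma_of_sum_eq_zero`).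

The candidates are incomparable: `P_Δ` contains no `L_J`, and explicit sums of two rank-one tables
lie on one `Q_{i₁,i₂}` and on no other candidate (`exists_point_twoFacetIdeal`).

For primality, fix a base cell `o` and use as linear coordinates the entries of the margins on the
supports `{j | i_j ≠ o_j}`. The subalgebra generated by the margins in `Δ` becomes a polynomial
subring, so `P_Δ` is extended from a prime of it (`mainIdeal_isPrime`). The ideal `Q_{i₁,i₂}`
becomes the kernel of a substitution of monomials and zeros (`twoFacetIdeal_isPrime`). -/

noncomputable section

namespace MarginalIndependence

open Function MvPolynomial

variable {K : Type*} [Field K] {n : ℕ} {a : Fin n → ℕ}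
variable {Δ : Set (Finset (Fin n))} {J₁ J₂ : Finset (Fin n)}

/-! ### Exchange relations and rank-one tables. -/

section Tables

variable {ι : Type*} [DecidableEq ι] {β : ι → Type*}

/-- A table satisfies all the exchange relations, i.e. all its generalized `2 × 2` minors vanish. -/
def IsSwap {M : Type*} [Mul M] (b : ((j : ι) → β j) → M) : Prop :=
  ∀ (l : ι) (i k : (j : ι) → β j),
    b i * b k = b (update k l (i l)) * b (update i l (k l))

/-- A table depends only on the coordinates in `J`. -/
def DependsOnlyOn {M : Type*} (b : ((j : ι) → β j) → M) (J : Finset ι) : Prop :=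
  ∀ i k : (j : ι) → β j, (∀ j ∈ J, i j = k j) → b i = b k

theorem isSwap_prod {M : Type*} [CommMonoid M] (J : Finset ι) (w : (j : ι) → β j → M) :
    IsSwap fun i : (j : ι) → β j => ∏ j ∈ J, w j (i j) := by
  intro l i k
  simp only [← Finset.prod_mul_distrib]
  refine Finset.prod_congr rfl fun j _ => ?_
  by_cases h : j = l
  · subst h; simp
  · simp [update_of_ne h, mul_comm]

theorem isSwap_iff_segreIdeal {R B : Type*} [CommRing R] [CommRing B] (φ : R →+* B)
    (b : ((j : ι) → β j) → R) :
    segreIdeal b ≤ RingHom.ker φ ↔ IsSwap fun i => φ (b i) := by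
  rw [segreIdeal, Ideal.span_le]
  constructor
  · intro h l i k
    have := h ⟨l, i, k, rfl⟩
    simpa [sub_eq_zero] using this
  · rintro h _ ⟨l, i, k, rfl⟩
    simpa [sub_eq_zero] using h l i k

/-- A matrix `g` acting on one direction preserves rank one: each minor of `b'` is a combination of
minors of `b`. With all coefficients `1` this is summation over the direction. -/
theorem IsSwap.transform {R : Type*} [CommRing R] {b b' : ((j : ι) → β j) → R} (hb : IsSwap b)
    (j : ι) [Fintype (β j)] (g : β j → β j → R)
    (h : ∀ i, b' i = ∑ x, g (i j) x * b (update i j x)) : IsSwap b' := by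
  intro l i k
  by_cases hl : l = j
  · subst hl
    simp only [h, Finset.sum_mul_sum, update_self, update_idem]
    refine Finset.sum_congr rfl fun x _ => Finset.sum_congr rfl fun y _ => ?_
    have := hb l (update i l x) (update k l y)
    simp only [update_self, update_idem] at this
    linear_combination g (i l) x * g (k l) y * this
  · simp only [h, Finset.sum_mul_sum]
    rw [Finset.sum_comm]
    refine Finset.sum_congr rfl fun x _ => Finset.sum_congr rfl fun y _ => ?_
    have := hb l (update i j y) (update k j x)
    rw [update_of_ne hl, update_of_ne hl, update_comm (Ne.symm hl), update_comm (Ne.symm hl)] at this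
    rw [update_of_ne (Ne.symm hl), update_of_ne (Ne.symm hl)]
    linear_combination g (i j) y * g (k j) x * this

/-- Normalise at a cell `s` with `b s ≠ 0` and move the coordinates of `i` to those of `s` one at a
time; each move splits off a factor depending on a single coordinate. Nonemptiness of `J` leaves
room for the scalar `b s`, or for a zero factor. -/
theorem IsSwap.exists_eq_prod {F : Type*} [Field F] {b : ((j : ι) → β j) → F} (hb : IsSwap b)
    {J : Finset ι} (hJ : J.Nonempty) (hbJ : DependsOnlyOn b J) :
    ∃ w : (j : ι) → β j → F, ∀ i, b i = ∏ j ∈ J, w j (i j) := by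
  by_cases h0 : ∀ i, b i = 0
  · obtain ⟨j, hj⟩ := hJ
    exact ⟨fun _ _ => 0, fun i => by rw [h0, Finset.prod_eq_zero hj rfl]⟩
  push Not at h0
  obtain ⟨s, hs⟩ := h0
  let u : (j : ι) → β j → F := fun j v => b (update s j v) / b s
  have key : ∀ (E : Finset ι) (i), b i = (∏ j ∈ E, u j (i j)) * b (E.piecewise s i) := by
    intro E
    induction E using Finset.induction_on with
    | empty => intro i; simp
    | insert l E hl ih =>
      intro i
      rw [ih i, Finset.prod_insert hl]
      have := hb l (E.piecewise s i) s
      rw [Finset.piecewise_eq_of_notMem _ _ _ hl] at this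
      have h2 : update (E.piecewise s i) l (s l) = (insert l E).piecewise s i := by
        rw [Finset.piecewise_insert]
      rw [h2] at this
      have h3 : b (E.piecewise s i) = u l (i l) * b ((insert l E).piecewise s i) := by
        simp only [u]; field_simp; exact this
      rw [h3]; ring
  obtain ⟨d, hd⟩ := hJ
  refine ⟨fun j v => (if j = d then b s else 1) * u j v, fun i => ?_⟩
  rw [Finset.prod_mul_distrib, Finset.prod_ite_eq' J d, if_pos hd, key J i,
    hbJ (J.piecewise s i) s fun j hj => Finset.piecewise_eq_of_mem _ _ _ hj, mul_comm]

/-- Exchanging one coordinate between two factors changes neither the product nor the marginal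
multisets, so one factor can be steered towards the cell `i`, a coordinate at a time. -/
theorem IsSwap.exists_cons {M : Type*} [CommMonoid M] {b : ((j : ι) → β j) → M} (hb : IsSwap b)
    (m : Multiset ((j : ι) → β j)) (hm : m ≠ 0) (i : (j : ι) → β j)
    (hi : ∀ j, i j ∈ m.map fun k => k j) (E : Finset ι) :
    ∃ k m', (∀ j ∈ E, k j = i j) ∧ (∀ j, (k ::ₘ m').map (fun k => k j) = m.map fun k => k j) ∧
      ((k ::ₘ m').map b).prod = (m.map b).prod := by
  induction E using Finset.induction_on with
  | empty =>
    obtain ⟨k, hk⟩ := Multiset.exists_mem_of_ne_zero hm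
    obtain ⟨m', rfl⟩ := Multiset.exists_cons_of_mem hk
    exact ⟨k, m', by simp, fun _ => rfl, rfl⟩
  | insert l E hl ih =>
    obtain ⟨k, m', h1, h2, h3⟩ := ih
    by_cases hkl : k l = i l
    · exact ⟨k, m', by simpa [hkl] using h1, h2, h3⟩
    have := hi l
    rw [← h2 l, Multiset.map_cons, Multiset.mem_cons] at this
    obtain ⟨k', hk', hk'l⟩ := Multiset.mem_map.1 (this.resolve_left (Ne.symm hkl))
    obtain ⟨m'', rfl⟩ := Multiset.exists_cons_of_mem hk'
    refine ⟨update k l (k' l), update k' l (k l) ::ₘ m'', ?_, ?_, ?_⟩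
    · intro j hj
      rcases Finset.mem_insert.1 hj with rfl | hjE
      · simpa using hk'l
      · rw [update_of_ne (ne_of_mem_of_not_mem hjE hl), h1 j hjE]
    · intro j
      rw [← h2 j]
      simp only [Multiset.map_cons]
      by_cases hj : j = l
      · subst hj; simp only [update_self]; exact Multiset.cons_swap _ _ _
      · simp only [update_of_ne hj]
    · rw [← h3]
      simp only [Multiset.map_cons, Multiset.prod_cons, ← mul_assoc]
      rw [hb l k k', mul_comm (b (update k l (k' l)))]

/-- Products of the entries of a table satisfying the exchange relations only depend on the
marginal multisets of the indices. -/
theorem IsSwap.prod_eq_prod [Fintype ι] [Nonempty ι] {M : Type*} [CommMonoid M]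
    {b : ((j : ι) → β j) → M} (hb : IsSwap b) (m m' : Multiset ((j : ι) → β j))
    (h : ∀ j, m.map (fun k => k j) = m'.map fun k => k j) :
    (m.map b).prod = (m'.map b).prod := by
  induction m' using Multiset.induction_on generalizing m with
  | empty =>
    have : m = 0 := by simpa using h (Classical.arbitrary ι)
    rw [this]
  | cons i m' ih =>
    have hm : m ≠ 0 := by
      rintro rfl
      simpa using h (Classical.arbitrary ι)
    obtain ⟨k, m'', h1, h2, h3⟩ := hb.exists_cons m hm i
      (fun j => by rw [h j]; simp) Finset.univ
    obtain rfl : k = i := funext fun j => h1 j (Finset.mem_univ j)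
    rw [← h3, Multiset.map_cons, Multiset.map_cons, Multiset.prod_cons, Multiset.prod_cons,
      ih m'' fun j => ?_]
    have := (h2 j).trans (h j)
    rwa [Multiset.map_cons, Multiset.map_cons, Multiset.cons_inj_right] at this

end Tables

/-- The kernels of the powers of `f` stabilise, say at `m`. If `f x = 0` and `x = f^m y`, then `y`
is in the kernel of `f^(m+1)`, hence of `f^m`, so `x = 0`. -/
theorem injective_of_surjective_ringEnd {A : Type*} [CommRing A] [IsNoetherianRing A]
    (f : A →+* A) (hf : Surjective f) : Injective f := by
  let g : ℕ →o Ideal A := ⟨fun m => RingHom.ker (f ^ m), monotone_nat_of_le_succ fun m x hx => by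
    rw [RingHom.mem_ker] at hx ⊢
    rw [pow_succ', RingHom.mul_def, RingHom.comp_apply, hx, map_zero]⟩
  obtain ⟨m, hm⟩ := monotone_stabilizes_iff_noetherian.2 (inferInstanceAs (IsNoetherian A A)) g
  have hs : Surjective (f ^ m) := by
    rw [RingHom.coe_pow]; exact hf.iterate m
  rw [injective_iff_map_eq_zero]
  intro x hx
  obtain ⟨y, rfl⟩ := hs x
  have : y ∈ g (m + 1) := by
    change (f ^ (m + 1)) y = 0
    rw [pow_succ', RingHom.mul_def, RingHom.comp_apply, hx]
  rw [← hm (m + 1) (Nat.le_succ m)] at this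
  exact this

/-! ### Margins viewed as tables on the full index set. -/

section FullMargin

variable (K) in
/-- The margin `A_J` as a table indexed by the cells of the full table. -/
def fullMargin (J : Finset (Fin n)) (i : (j : Fin n) → Fin (a j)) : TableRing K a :=
  margin K a J fun j => i j

theorem fullMargin_eq (J : Finset (Fin n)) (i : (j : Fin n) → Fin (a j)) :
    fullMargin K J i = ∑ k : (j : Fin n) → Fin (a j) with ∀ j ∈ J, k j = i j, X k := by
  simp [fullMargin, margin]

theorem dependsOnlyOn_fullMargin (J : Finset (Fin n)) :
    DependsOnlyOn (fullMargin K (a := a) J) J := by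
  intro i k h
  unfold fullMargin
  congr 1
  funext j
  exact h j j.2

theorem fullMargin_univ (i : (j : Fin n) → Fin (a j)) :
    fullMargin K Finset.univ i = X i := by
  have : (Finset.univ.filter fun k : (j : Fin n) → Fin (a j) => ∀ j ∈ Finset.univ, k j = i j)
      = {i} := by
    ext k; simp [funext_iff]
  rw [fullMargin_eq, this, Finset.sum_singleton]

theorem fullMargin_eq_sum {J : Finset (Fin n)} {l : Fin n} (hl : l ∉ J)
    (i : (j : Fin n) → Fin (a j)) :
    fullMargin K J i = ∑ v, fullMargin K (insert l J) (update i l v) := by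
  simp only [fullMargin_eq]
  rw [← Finset.sum_fiberwise_of_maps_to (t := Finset.univ) (g := fun k => k l)
    fun _ _ => Finset.mem_univ _]
  refine Finset.sum_congr rfl fun v _ => ?_
  refine Finset.sum_congr ?_ fun _ _ => rfl
  ext k
  simp only [Finset.mem_filter, Finset.mem_univ, true_and, Finset.mem_insert, forall_eq_or_imp,
    update_self]
  rw [and_comm]
  refine and_congr_right fun _ => forall₂_congr fun j hj => ?_
  rw [update_of_ne (ne_of_mem_of_not_mem hj hl)]

/-- Every cell of a margin is the restriction of a cell of the full table. -/
theorem exists_restrict (ha : ∀ j, 1 ≤ a j) {J : Finset (Fin n)} (s : Cell a J) :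
    ∃ i : (j : Fin n) → Fin (a j), (fun j : J => i j) = s :=
  ⟨fun j => if h : j ∈ J then s ⟨j, h⟩ else ⟨0, ha j⟩, funext fun j => dif_pos j.2⟩

theorem marginIdeal_le_ker_iff (ha : ∀ j, 1 ≤ a j) {B : Type*} [CommRing B]
    (φ : TableRing K a →+* B) (J : Finset (Fin n)) :
    marginIdeal K a J ≤ RingHom.ker φ ↔ ∀ i, φ (fullMargin K J i) = 0 := by
  rw [marginIdeal, Ideal.span_le, Set.range_subset_iff]
  refine ⟨fun h i => h _, fun h s => ?_⟩
  obtain ⟨i, rfl⟩ := exists_restrict ha s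
  exact h i

theorem segreIdeal_margin_le_ker_iff (ha : ∀ j, 1 ≤ a j) {B : Type*} [CommRing B]
    (φ : TableRing K a →+* B) (J : Finset (Fin n)) :
    segreIdeal (margin K a J) ≤ RingHom.ker φ ↔ IsSwap fun i => φ (fullMargin K J i) := by
  rw [isSwap_iff_segreIdeal]
  have key : ∀ (i : (j : Fin n) → Fin (a j)) (l : J) (v : Fin (a l)),
      (fun j : J => update i l v j) = update (fun j : J => i j) l v := by
    intro i l v
    funext j
    by_cases h : j = l
    · subst h; simp
    · rw [update_of_ne h, update_of_ne (fun e => h (Subtype.ext e))]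
  constructor
  · intro h l i k
    by_cases hl : l ∈ J
    · have := h ⟨l, hl⟩ (fun j => i j) (fun j => k j)
      rw [← key k ⟨l, hl⟩, ← key i ⟨l, hl⟩] at this
      exact this
    · have aux : ∀ (i : (j : Fin n) → Fin (a j)) v,
          fullMargin K J (update i l v) = fullMargin K J i := fun i v =>
        dependsOnlyOn_fullMargin J _ _ fun j hj => update_of_ne (ne_of_mem_of_not_mem hj hl) _ _
      simp only [aux]
      rw [mul_comm]
  · intro h l s t
    obtain ⟨i, rfl⟩ := exists_restrict ha s
    obtain ⟨k, rfl⟩ := exists_restrict ha t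
    have := h l i k
    simp only [fullMargin, key] at this
    exact this

/-- If the image of `A_{J₁}` is a product table, then so are the images of the smaller margins. -/
theorem map_fullMargin_eq_prod {B : Type*} [CommRing B] (φ : TableRing K a →+* B)
    {J₁ : Finset (Fin n)} (w : (j : Fin n) → Fin (a j) → B)
    (h : ∀ i, φ (fullMargin K J₁ i) = ∏ j ∈ J₁, w j (i j)) {J : Finset (Fin n)} (hJ : J ⊆ J₁)
    (i : (j : Fin n) → Fin (a j)) :
    φ (fullMargin K J i) = (∏ j ∈ J, w j (i j)) * ∏ j ∈ J₁ \ J, ∑ v, w j v := by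
  induction hE : J₁ \ J using Finset.induction_on generalizing J i with
  | empty =>
    obtain rfl : J = J₁ := hJ.antisymm (Finset.sdiff_eq_empty_iff_subset.1 hE)
    simp [h]
  | insert l E hl ih =>
    have hlJ : l ∈ J₁ \ J := hE ▸ Finset.mem_insert_self l E
    rw [Finset.mem_sdiff] at hlJ
    have h1 : J₁ \ insert l J = E := by
      rw [Finset.sdiff_insert, hE, Finset.erase_insert hl]
    rw [fullMargin_eq_sum hlJ.2, map_sum, Finset.prod_insert hl, ← mul_assoc, Finset.mul_sum,
      Finset.sum_mul]
    refine Finset.sum_congr rfl fun v _ => ?_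
    rw [ih (Finset.insert_subset hlJ.1 hJ) _ h1, Finset.prod_insert hlJ.2, update_self,
      mul_comm (w l v)]
    congr 2
    exact Finset.prod_congr rfl fun j hj => by rw [update_of_ne (ne_of_mem_of_not_mem hj hlJ.2)]

theorem map_fullMargin_eq_zero {B : Type*} [CommRing B] (φ : TableRing K a →+* B)
    {J J' : Finset (Fin n)} (h : ∀ i, φ (fullMargin K J' i) = 0) (hJ : J ⊆ J')
    (i : (j : Fin n) → Fin (a j)) : φ (fullMargin K J i) = 0 := by
  induction hE : J' \ J using Finset.induction_on generalizing J i with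
  | empty =>
    obtain rfl : J = J' := hJ.antisymm (Finset.sdiff_eq_empty_iff_subset.1 hE)
    exact h i
  | insert l E hl ih =>
    have hlJ : l ∈ J' \ J := hE ▸ Finset.mem_insert_self l E
    rw [Finset.mem_sdiff] at hlJ
    have h1 : J' \ insert l J = E := by
      rw [Finset.sdiff_insert, hE, Finset.erase_insert hl]
    rw [fullMargin_eq_sum hlJ.2, map_sum]
    exact Finset.sum_eq_zero fun v _ => ih (Finset.insert_subset hlJ.1 hJ) _ h1

/-- Removing a direction from a margin is a summation over it, an instance of `IsSwap.transform`.
This reduces `I_Δ` to the relations of the two facets. -/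
theorem isSwap_fullMargin_mono {B : Type*} [CommRing B] (φ : TableRing K a →+* B)
    {J J' : Finset (Fin n)} (h : IsSwap fun i => φ (fullMargin K J' i)) (hJ : J ⊆ J') :
    IsSwap fun i => φ (fullMargin K J i) := by
  induction hE : J' \ J using Finset.induction_on generalizing J with
  | empty =>
    obtain rfl : J = J' := hJ.antisymm (Finset.sdiff_eq_empty_iff_subset.1 hE)
    exact h
  | insert l E hl ih =>
    have hlJ : l ∈ J' \ J := hE ▸ Finset.mem_insert_self l E
    rw [Finset.mem_sdiff] at hlJ
    have h1 : J' \ insert l J = E := by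
      rw [Finset.sdiff_insert, hE, Finset.erase_insert hl]
    refine (ih (Finset.insert_subset hlJ.1 hJ) h1).transform l (fun _ _ => 1) fun i => ?_
    rw [fullMargin_eq_sum hlJ.2, map_sum]
    simp

end FullMargin

/-! ### Complexes with two facets. -/

section Facets

theorem mem_iff_of_facets (hΔ : IsLowerSet Δ) (hfacets : facets Δ = {J₁, J₂})
    (J : Finset (Fin n)) : J ∈ Δ ↔ J ⊆ J₁ ∨ J ⊆ J₂ := by
  have h1 : J₁ ∈ facets Δ := by rw [hfacets]; simp
  have h2 : J₂ ∈ facets Δ := by rw [hfacets]; simp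
  constructor
  · intro hJ
    obtain ⟨M, hM, hmax⟩ := (Set.toFinite Δ).exists_le_maximal hJ
    have : M ∈ facets Δ := hmax
    rw [hfacets] at this
    rcases this with rfl | rfl
    · exact Or.inl hM
    · exact Or.inr hM
  · rintro (h | h)
    · exact hΔ h h1.prop
    · exact hΔ h h2.prop

theorem sdiff_nonempty_of_facets (hJ : J₁ ≠ J₂) (hfacets : facets Δ = {J₁, J₂}) :
    (J₁ \ J₂).Nonempty ∧ (J₂ \ J₁).Nonempty := by
  have h1 : J₁ ∈ facets Δ := by rw [hfacets]; simp
  have h2 : J₂ ∈ facets Δ := by rw [hfacets]; simp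
  constructor
  · rw [Finset.sdiff_nonempty]
    exact fun h => hJ (h.antisymm (h1.2 h2.prop h))
  · rw [Finset.sdiff_nonempty]
    exact fun h => hJ ((h2.2 h1.prop h).antisymm h)

theorem independenceIdeal_le_ker_iff (ha : ∀ j, 1 ≤ a j)
    (hmem : ∀ J, J ∈ Δ ↔ J ⊆ J₁ ∨ J ⊆ J₂) {B : Type*} [CommRing B] (φ : TableRing K a →+* B) :
    independenceIdeal K a Δ ≤ RingHom.ker φ ↔
      (IsSwap fun i => φ (fullMargin K J₁ i)) ∧ IsSwap fun i => φ (fullMargin K J₂ i) := by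
  simp only [independenceIdeal, iSup_le_iff, segreIdeal_margin_le_ker_iff ha]
  constructor
  · exact fun h => ⟨h J₁ ((hmem _).2 (Or.inl le_rfl)), h J₂ ((hmem _).2 (Or.inr le_rfl))⟩
  · rintro ⟨h1, h2⟩ J hJ
    rcases (hmem J).1 hJ with h | h
    · exact isSwap_fullMargin_mono φ h1 h
    · exact isSwap_fullMargin_mono φ h2 h

theorem twoFacetIdeal_le_ker_iff (ha : ∀ j, 1 ≤ a j)
    (hmem : ∀ J, J ∈ Δ ↔ J ⊆ J₁ ∨ J ⊆ J₂) {B : Type*} [CommRing B] (φ : TableRing K a →+* B)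
    (i₁ i₂ : Fin n) :
    twoFacetIdeal K a Δ J₁ J₂ i₁ i₂ ≤ RingHom.ker φ ↔
      ((IsSwap fun i => φ (fullMargin K J₁ i)) ∧ IsSwap fun i => φ (fullMargin K J₂ i)) ∧
        (∀ i, φ (fullMargin K (J₁.erase i₁) i) = 0) ∧
          ∀ i, φ (fullMargin K (J₂.erase i₂) i) = 0 := by
  rw [twoFacetIdeal, Submodule.add_eq_sup, Submodule.add_eq_sup, sup_le_iff, sup_le_iff,
    independenceIdeal_le_ker_iff ha hmem, marginIdeal_le_ker_iff ha, marginIdeal_le_ker_iff ha,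
    and_assoc]

end Facets

/-! ### Maps given by a family of vectors, and vanishing on `ker σ_Δ`. -/

/-- The homomorphism `g` sends the formal entries of the margins below `J'` to the entries of the
corresponding margins of the product table `∏ j ∈ J', w j`. -/
def IsProductOn {E : Type*} [CommRing E] [Algebra K E] (g : MarginRing K a Δ →ₐ[K] E)
    (w : (j : Fin n) → Fin (a j) → E) (J' : Finset (Fin n)) : Prop :=
  ∀ (J : Finset (Fin n)) (hJ : J ∈ Δ) (i : (j : Fin n) → Fin (a j)), J ⊆ J' →
    g (X ⟨⟨J, hJ⟩, fun j => i j⟩) = (∏ j ∈ J, w j (i j)) * ∏ j ∈ J' \ J, ∑ v, w j v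

theorem IsProductOn.congr {E : Type*} [CommRing E] [Algebra K E] {g : MarginRing K a Δ →ₐ[K] E}
    {w w' : (j : Fin n) → Fin (a j) → E} {J' : Finset (Fin n)} (h : IsProductOn g w J')
    (hw : ∀ j ∈ J', w j = w' j) : IsProductOn g w' J' := by
  intro J hJ i hJJ
  rw [h J hJ i hJJ]
  congr 1
  · exact Finset.prod_congr rfl fun j hj => by rw [hw j (hJJ hj)]
  · exact Finset.prod_congr rfl fun j hj => by rw [hw j (Finset.mem_sdiff.1 hj).1]

theorem isProductOn_comp_tau {E : Type*} [CommRing E] [Algebra K E] (φ : TableRing K a →ₐ[K] E)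
    (w : (j : Fin n) → Fin (a j) → E) (J' : Finset (Fin n))
    (h : ∀ i, φ (fullMargin K J' i) = ∏ j ∈ J', w j (i j)) :
    IsProductOn (φ.comp (tau K a Δ)) w J' := by
  intro J hJ i hJJ
  rw [AlgHom.comp_apply, tau, aeval_X]
  exact map_fullMargin_eq_prod φ.toRingHom w h hJJ i

theorem algHom_ext_of_isProductOn (ha : ∀ j, 1 ≤ a j) (hmem : ∀ J, J ∈ Δ ↔ J ⊆ J₁ ∨ J ⊆ J₂)
    {E : Type*} [CommRing E] [Algebra K E] {g g' : MarginRing K a Δ →ₐ[K] E}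
    {w : (j : Fin n) → Fin (a j) → E} (h₁ : IsProductOn g w J₁) (h₂ : IsProductOn g w J₂)
    (h₁' : IsProductOn g' w J₁) (h₂' : IsProductOn g' w J₂) : g = g' := by
  refine MvPolynomial.algHom_ext fun ⟨⟨J, hJ⟩, s⟩ => ?_
  obtain ⟨i, rfl⟩ := exists_restrict ha s
  rcases (hmem J).1 hJ with h | h
  · rw [h₁ J hJ i h, h₁' J hJ i h]
  · rw [h₂ J hJ i h, h₂' J hJ i h]

theorem IsProductOn.comp {E E' : Type*} [CommRing E] [Algebra K E] [CommRing E'] [Algebra K E']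
    {g : MarginRing K a Δ →ₐ[K] E} {w : (j : Fin n) → Fin (a j) → E} {J' : Finset (Fin n)}
    (h : IsProductOn g w J') (φ : E →ₐ[K] E') :
    IsProductOn (φ.comp g) (fun j v => φ (w j v)) J' := by
  intro J hJ i hJJ
  rw [AlgHom.comp_apply, h J hJ i hJJ]
  simp only [map_mul, map_prod, map_sum]

theorem segreMap_fullMargin_univ (i : (j : Fin n) → Fin (a j)) :
    segreMap K a (fullMargin K Finset.univ i) = ∏ j, X ⟨j, i j⟩ := by
  rw [fullMargin_univ, segreMap, aeval_X]

/-- The family `w` is completed to a full rank-one table `y` whose `J₁`- and `J₂`-margins are the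
two product tables; then `g` is `σ_Δ` followed by an evaluation. The hypothesis `hN` is the
compatibility of the two tables on `J₁ ∩ J₂`. -/
theorem eq_zero_of_mem_ker_sigma_of_field (ha : ∀ j, 1 ≤ a j)
    (hmem : ∀ J, J ∈ Δ ↔ J ⊆ J₁ ∨ J ⊆ J₂) {d : Fin n} (hd : d ∈ J₁ \ J₂)
    {F : Type*} [Field F] [Algebra K F] {g : MarginRing K a Δ →ₐ[K] F}
    {w : (j : Fin n) → Fin (a j) → F} (h₁ : IsProductOn g w J₁) (h₂ : IsProductOn g w J₂)
    (hN : ∏ j ∈ J₁ \ J₂, ∑ v, w j v = ∏ j ∈ J₂ \ J₁, ∑ v, w j v)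
    (hN0 : ∏ j ∈ J₁ \ J₂, ∑ v, w j v ≠ 0) {f : MarginRing K a Δ}
    (hf : f ∈ RingHom.ker (sigma K a Δ)) : g f = 0 := by
  set N := ∏ j ∈ J₁ \ J₂, ∑ v, w j v with hNdef
  obtain ⟨hd1, hd2⟩ := Finset.mem_sdiff.1 hd
  -- Directions outside `J₁ ∪ J₂` get vectors of sum `1`. The `J₁`-margin of the unscaled table
  -- carries the extra factor `∏_{J₂ \ J₁} ∑ w = N`, the `J₂`-margin the factor `∏_{J₁ \ J₂} ∑ w =
  -- N`; one factor `N⁻¹` in direction `d` corrects both.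
  let y : (j : Fin n) → Fin (a j) → F := fun j v =>
    if j ∈ J₁ ∪ J₂ then (if j = d then N⁻¹ else 1) * w j v else if v = ⟨0, ha j⟩ then 1 else 0
  have hy : ∀ j ∈ J₁ ∪ J₂, ∀ v, y j v = (if j = d then N⁻¹ else 1) * w j v := fun j hj v =>
    if_pos hj
  have hy0 : ∀ j ∉ J₁ ∪ J₂, ∑ v, y j v = 1 := fun j hj => by simp only [y, if_neg hj]; simp
  have hys : ∀ j ∈ J₁ ∪ J₂, ∑ v, y j v = (if j = d then N⁻¹ else 1) * ∑ v, w j v := fun j hj => by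
    rw [Finset.mul_sum]; exact Finset.sum_congr rfl fun v _ => hy j hj v
  let h : TableRing K a →ₐ[K] F := (aeval fun p : (j : Fin n) × Fin (a j) => y p.1 p.2).comp
    (segreMap K a)
  have hu : ∀ i, h (fullMargin K Finset.univ i) = ∏ j, y j (i j) := fun i => by
    rw [AlgHom.comp_apply, segreMap_fullMargin_univ]
    simp
  have hm1 : ∀ i, h (fullMargin K J₁ i) = ∏ j ∈ J₁, w j (i j) := fun i => by
    have h1 := map_fullMargin_eq_prod h.toRingHom y hu (Finset.subset_univ J₁) i
    refine h1.trans ?_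
    have h2 : ∏ j ∈ Finset.univ \ J₁, ∑ v, y j v = N := by
      rw [hN]
      symm
      refine (Finset.prod_congr rfl fun j hj => ?_).trans
        (Finset.prod_subset (Finset.sdiff_subset_sdiff (Finset.subset_univ J₂) le_rfl) fun j hj hj' =>
          hy0 j ?_)
      · rw [Finset.mem_sdiff] at hj
        rw [hys j (Finset.mem_union_right _ hj.1), if_neg (ne_of_mem_of_not_mem hd1 hj.2).symm,
          one_mul]
      · simp only [Finset.mem_sdiff, Finset.mem_univ, true_and, not_and, not_not] at hj hj'
        simp only [Finset.mem_union, not_or]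
        exact ⟨hj, fun h => hj (hj' h)⟩
    rw [h2, Finset.prod_congr rfl fun j hj => hy j (Finset.mem_union_left _ hj) (i j),
      Finset.prod_mul_distrib, Finset.prod_ite_eq', if_pos hd1]
    field_simp
  have hm2 : ∀ i, h (fullMargin K J₂ i) = ∏ j ∈ J₂, w j (i j) := fun i => by
    have h1 := map_fullMargin_eq_prod h.toRingHom y hu (Finset.subset_univ J₂) i
    refine h1.trans ?_
    have h2 : ∏ j ∈ Finset.univ \ J₂, ∑ v, y j v = 1 := by
      rw [← inv_mul_cancel₀ hN0, hNdef]
      symm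
      rw [← hNdef]
      have : N⁻¹ * N = ∏ j ∈ J₁ \ J₂, (if j = d then N⁻¹ else 1) * ∑ v, w j v := by
        rw [Finset.prod_mul_distrib, Finset.prod_ite_eq', if_pos hd]
      rw [this]
      refine (Finset.prod_congr rfl fun j hj => ?_).trans
        (Finset.prod_subset (Finset.sdiff_subset_sdiff (Finset.subset_univ J₁) le_rfl) fun j hj hj' =>
          hy0 j ?_)
      · rw [hys j (Finset.mem_union_left _ (Finset.mem_sdiff.1 hj).1)]
      · simp only [Finset.mem_sdiff, Finset.mem_univ, true_and, not_and, not_not] at hj hj'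
        simp only [Finset.mem_union, not_or]
        exact ⟨fun h => hj (hj' h), hj⟩
    rw [h2, Finset.prod_congr rfl fun j hj => hy j (Finset.mem_union_right _ hj) (i j),
      Finset.prod_mul_distrib, Finset.prod_ite_eq', if_neg hd2]
    ring
  have := algHom_ext_of_isProductOn ha hmem h₁ h₂ (isProductOn_comp_tau h w J₁ hm1)
    (isProductOn_comp_tau h w J₂ hm2)
  rw [this]
  change aeval _ (sigma K a Δ f) = 0
  rw [RingHom.mem_ker.1 hf, map_zero]

theorem eq_zero_of_mem_ker_sigma (ha : ∀ j, 1 ≤ a j)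
    (hmem : ∀ J, J ∈ Δ ↔ J ⊆ J₁ ∨ J ⊆ J₂) {d : Fin n} (hd : d ∈ J₁ \ J₂)
    {E : Type*} [CommRing E] [IsDomain E] [Algebra K E] {g : MarginRing K a Δ →ₐ[K] E}
    {w : (j : Fin n) → Fin (a j) → E} (h₁ : IsProductOn g w J₁) (h₂ : IsProductOn g w J₂)
    (hN : ∏ j ∈ J₁ \ J₂, ∑ v, w j v = ∏ j ∈ J₂ \ J₁, ∑ v, w j v)
    (hN0 : ∏ j ∈ J₁ \ J₂, ∑ v, w j v ≠ 0) {f : MarginRing K a Δ}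
    (hf : f ∈ RingHom.ker (sigma K a Δ)) : g f = 0 := by
  let φ : E →ₐ[K] FractionRing E := IsScalarTower.toAlgHom K E (FractionRing E)
  have hφ : Injective φ := IsFractionRing.injective E (FractionRing E)
  refine (map_eq_zero_iff φ hφ).1 (eq_zero_of_mem_ker_sigma_of_field ha hmem hd
    (h₁.comp φ) (h₂.comp φ) ?_ ?_ hf)
  · simpa only [← map_sum, ← map_prod] using congrArg φ hN
  · simp only [← map_sum, ← map_prod]
    rwa [Ne, map_eq_zero_iff φ hφ]

theorem exists_isProductOn {E : Type*} [CommRing E] [Algebra K E] (w : (j : Fin n) → Fin (a j) → E)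
    (hN : ∏ j ∈ J₁ \ J₂, ∑ v, w j v = ∏ j ∈ J₂ \ J₁, ∑ v, w j v) :
    ∃ g : MarginRing K a Δ →ₐ[K] E, IsProductOn g w J₁ ∧ IsProductOn g w J₂ := by
  classical
  -- For faces below both facets the two prescriptions agree by `hN`, so choosing `J₁` there is
  -- harmless.
  let J' : Finset (Fin n) → Finset (Fin n) := fun J => if J ⊆ J₁ then J₁ else J₂
  let g : MarginRing K a Δ →ₐ[K] E := aeval fun p =>
    (∏ j : p.1.1, w j (p.2 j)) * ∏ j ∈ J' p.1.1 \ p.1.1, ∑ v, w j v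
  have hg : ∀ J (hJ : J ∈ Δ) (i : (j : Fin n) → Fin (a j)), g (X ⟨⟨J, hJ⟩, fun j => i j⟩) =
      (∏ j ∈ J, w j (i j)) * ∏ j ∈ J' J \ J, ∑ v, w j v := fun J hJ i => by
    rw [aeval_X]
    change (∏ j : J, w j (i j)) * _ = _
    rw [Finset.prod_coe_sort J fun j => w j (i j)]
  have split : ∀ {A B J : Finset (Fin n)} (q : Fin n → E), J ⊆ A → J ⊆ B →
      ∏ j ∈ A \ J, q j = (∏ j ∈ A \ B, q j) * ∏ j ∈ (A ∩ B) \ J, q j := fun {A B J} q hA hB => by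
    rw [← Finset.prod_union]
    · congr 1
      ext j
      have := @hB j
      simp only [Finset.mem_sdiff, Finset.mem_union, Finset.mem_inter]
      tauto
    · rw [Finset.disjoint_left]
      intro j
      simp only [Finset.mem_sdiff, Finset.mem_inter]
      tauto
  refine ⟨g, fun J hJ i h => ?_, fun J hJ i h => ?_⟩
  · rw [hg, show J' J = J₁ from if_pos h]
  · rw [hg]
    by_cases h1 : J ⊆ J₁
    · rw [show J' J = J₁ from if_pos h1, split _ h1 h, split _ h h1, hN, Finset.inter_comm]
    · rw [show J' J = J₂ from if_neg h1]

/-- Here both products of sums vanish, so rescaling is impossible. The family is deformed over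
`E[X]` to one with equal nonzero products of sums, to which `eq_zero_of_mem_ker_sigma` applies;
setting `X = 0` recovers `g`. -/
theorem eq_zero_of_mem_ker_sigma_of_sum_eq_zero (ha : ∀ j, 1 ≤ a j)
    (hmem : ∀ J, J ∈ Δ ↔ J ⊆ J₁ ∨ J ⊆ J₂) {i₁ i₂ : Fin n} (hi₁ : i₁ ∈ J₁ \ J₂)
    (hi₂ : i₂ ∈ J₂ \ J₁) {E : Type*} [CommRing E] [IsDomain E] [Algebra K E]
    {g : MarginRing K a Δ →ₐ[K] E} {w : (j : Fin n) → Fin (a j) → E}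
    (h₁ : IsProductOn g w J₁) (h₂ : IsProductOn g w J₂) (hw₁ : ∑ v, w i₁ v = 0)
    (hw₂ : ∑ v, w i₂ v = 0) {f : MarginRing K a Δ} (hf : f ∈ RingHom.ker (sigma K a Δ)) :
    g f = 0 := by
  classical
  let q : Fin n → Polynomial E := fun j => Polynomial.X + Polynomial.C (∑ v, w j v)
  let A : Polynomial E := ∏ j ∈ (J₁ \ J₂).erase i₁, q j
  let B : Polynomial E := ∏ j ∈ (J₂ \ J₁).erase i₂, q j
  -- The cross choice of `A` and `B` turns both products of sums into `X * (A * B)`; the other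
  -- directions are perturbed by `X` so that their sums are nonzero.
  let c : Fin n → Polynomial E := fun j => if j = i₁ then B else if j = i₂ then A else 1
  let W : (j : Fin n) → Fin (a j) → Polynomial E := fun j v => Polynomial.C (w j v) +
    if v = ⟨0, ha j⟩ then Polynomial.X * c j else 0
  have hne : i₂ ≠ i₁ := ne_of_mem_of_not_mem (Finset.mem_sdiff.1 hi₂).1 (Finset.mem_sdiff.1 hi₁).2
  have hW : ∀ j, ∑ v, W j v = Polynomial.C (∑ v, w j v) + Polynomial.X * c j := fun j => by
    simp [W, Finset.sum_add_distrib]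
  have hWq : ∀ j, j ≠ i₁ → j ≠ i₂ → ∑ v, W j v = q j := fun j h1 h2 => by
    rw [hW]; simp only [c, if_neg h1, if_neg h2, q]; ring
  have hA : ∏ j ∈ J₁ \ J₂, ∑ v, W j v = Polynomial.X * (A * B) := by
    rw [← Finset.mul_prod_erase _ _ hi₁, hW, hw₁, Finset.prod_congr rfl fun j hj => hWq j
      (Finset.ne_of_mem_erase hj) (by
        rintro rfl
        exact (Finset.mem_sdiff.1 hi₂).2 (Finset.mem_sdiff.1 (Finset.mem_of_mem_erase hj)).1)]
    simp only [c, if_pos, Polynomial.C_0, A]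
    ring
  have hB : ∏ j ∈ J₂ \ J₁, ∑ v, W j v = Polynomial.X * (A * B) := by
    rw [← Finset.mul_prod_erase _ _ hi₂, hW, hw₂, Finset.prod_congr rfl fun j hj => hWq j
      (by
        rintro rfl
        exact (Finset.mem_sdiff.1 hi₁).2 (Finset.mem_sdiff.1 (Finset.mem_of_mem_erase hj)).1)
      (Finset.ne_of_mem_erase hj)]
    simp only [c, if_pos, if_neg hne, Polynomial.C_0, B]
    ring
  have hq : ∀ j, q j ≠ 0 := fun j => Polynomial.X_add_C_ne_zero _
  obtain ⟨g', h₁', h₂'⟩ := exists_isProductOn (K := K) (Δ := Δ) W (hA.trans hB.symm)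
  have hg' : g' f = 0 := eq_zero_of_mem_ker_sigma ha hmem hi₁ h₁' h₂' (hA.trans hB.symm) (by
    rw [hA]
    exact mul_ne_zero Polynomial.X_ne_zero (mul_ne_zero (Finset.prod_ne_zero_iff.2 fun j _ => hq j)
      (Finset.prod_ne_zero_iff.2 fun j _ => hq j))) hf
  let ev : Polynomial E →ₐ[K] E := (Polynomial.aeval (0 : E)).restrictScalars K
  have hev : (fun j v => ev (W j v)) = w := by
    funext j v
    simp only [ev, W, AlgHom.restrictScalars_apply, map_add, Polynomial.aeval_C]
    split_ifs <;> simp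
  have e₁ := h₁'.comp ev
  have e₂ := h₂'.comp ev
  rw [hev] at e₁ e₂
  rw [algHom_ext_of_isProductOn ha hmem h₁ h₂ e₁ e₂, AlgHom.comp_apply, hg', map_zero]

theorem mainIdeal_le_ker_iff {E : Type*} [CommRing E] [Algebra K E] (φ : TableRing K a →ₐ[K] E) :
    mainIdeal K a Δ ≤ RingHom.ker φ ↔
      ∀ f ∈ RingHom.ker (sigma K a Δ), (φ.comp (tau K a Δ)) f = 0 := by
  rw [mainIdeal, Ideal.map_le_iff_le_comap]
  rfl

/-! ### Primes over `I_Δ`: every one contains a candidate. -/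

theorem DependsOnlyOn.comp {ι : Type*} {β : ι → Type*} {M N : Type*} {J : Finset ι}
    {b : ((j : ι) → β j) → M} (hb : DependsOnlyOn b J) (φ : M → N) :
    DependsOnlyOn (fun i => φ (b i)) J := fun i k h => congrArg φ (hb i k h)

theorem prod_ite_eq_mul {ι M : Type*} [DecidableEq ι] [CommMonoid M] {J : Finset ι} {d : ι}
    (hd : d ∈ J) (q : ι → M) (c : M) :
    ∏ j ∈ J, (if j = d then c else 1) * q j = c * ∏ j ∈ J, q j := by
  rw [Finset.prod_mul_distrib, Finset.prod_ite_eq', if_pos hd]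

/-- A product table on `J₁` whose margin on `J₁ ∩ J₂` vanishes is given by vectors one of which,
in a direction outside of `J₂`, sums to zero. -/
theorem exists_sum_eq_zero {F : Type*} [Field F] (φ : TableRing K a →+* F)
    {d : Fin n} (hd : d ∈ J₁ \ J₂) (hs : IsSwap fun i => φ (fullMargin K J₁ i))
    (h0 : ∀ i, φ (fullMargin K (J₁ ∩ J₂) i) = 0) :
    ∃ i₁ ∈ J₁ \ J₂, ∃ u : (j : Fin n) → Fin (a j) → F,
      (∀ i, φ (fullMargin K J₁ i) = ∏ j ∈ J₁, u j (i j)) ∧ ∑ v, u i₁ v = 0 := by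
  have hd1 := (Finset.mem_sdiff.1 hd).1
  by_cases hz : ∀ i, φ (fullMargin K J₁ i) = 0
  · exact ⟨d, hd, fun _ _ => 0, fun i => by rw [hz, Finset.prod_eq_zero hd1 rfl], by simp⟩
  push Not at hz
  obtain ⟨s, hs0⟩ := hz
  obtain ⟨u, hu⟩ := hs.exists_eq_prod ⟨d, hd1⟩ ((dependsOnlyOn_fullMargin J₁).comp φ)
  have h1 := map_fullMargin_eq_prod φ u hu (Finset.inter_subset_left (s₂ := J₂)) s
  rw [h0, eq_comm, mul_eq_zero] at h1
  rw [hu, Finset.prod_ne_zero_iff] at hs0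
  rcases h1 with h1 | h1
  · obtain ⟨j, hj, h2⟩ := Finset.prod_eq_zero_iff.1 h1
    exact absurd h2 (hs0 j (Finset.mem_inter.1 hj).1)
  · rw [Finset.sdiff_inter_self_left] at h1
    obtain ⟨j, hj, h2⟩ := Finset.prod_eq_zero_iff.1 h1
    exact ⟨j, hj, u, hu, h2⟩

theorem map_fullMargin_erase_eq_zero {F : Type*} [CommRing F] (φ : TableRing K a →+* F)
    {i₁ : Fin n} (hi₁ : i₁ ∈ J₁) {u : (j : Fin n) → Fin (a j) → F}
    (hu : ∀ i, φ (fullMargin K J₁ i) = ∏ j ∈ J₁, u j (i j)) (h0 : ∑ v, u i₁ v = 0)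
    (i : (j : Fin n) → Fin (a j)) : φ (fullMargin K (J₁.erase i₁) i) = 0 := by
  have h : i₁ ∈ J₁ \ J₁.erase i₁ := by simp [hi₁]
  rw [map_fullMargin_eq_prod φ u hu (Finset.erase_subset _ _), Finset.prod_eq_zero h h0, mul_zero]

/-- If the margin on `J₁ ∩ J₂` does not vanish, the two product tables are, up to scalars,
parametrized by a single family of vectors. -/
theorem exists_common_family {F : Type*} [Field F] (φ : TableRing K a →+* F)
    {d₁ d₂ : Fin n} (hd₁ : d₁ ∈ J₁ \ J₂) (hd₂ : d₂ ∈ J₂ \ J₁)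
    (hs₁ : IsSwap fun i => φ (fullMargin K J₁ i)) (hs₂ : IsSwap fun i => φ (fullMargin K J₂ i))
    {s : (j : Fin n) → Fin (a j)} (hs : φ (fullMargin K (J₁ ∩ J₂) s) ≠ 0) :
    ∃ w : (j : Fin n) → Fin (a j) → F,
      (∀ i, φ (fullMargin K J₁ i) = ∏ j ∈ J₁, w j (i j)) ∧
      (∀ i, φ (fullMargin K J₂ i) = ∏ j ∈ J₂, w j (i j)) ∧
      ∏ j ∈ J₁ \ J₂, ∑ v, w j v = ∏ j ∈ J₂ \ J₁, ∑ v, w j v ∧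
      ∏ j ∈ J₁ \ J₂, ∑ v, w j v ≠ 0 := by
  obtain ⟨hd₁1, hd₁2⟩ := Finset.mem_sdiff.1 hd₁
  obtain ⟨hd₂1, hd₂2⟩ := Finset.mem_sdiff.1 hd₂
  obtain ⟨u, hu⟩ := hs₁.exists_eq_prod ⟨d₁, hd₁1⟩ ((dependsOnlyOn_fullMargin J₁).comp φ)
  obtain ⟨v, hv⟩ := hs₂.exists_eq_prod ⟨d₂, hd₂1⟩ ((dependsOnlyOn_fullMargin J₂).comp φ)
  have eu := map_fullMargin_eq_prod φ u hu (Finset.inter_subset_left (s₂ := J₂))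
  have ev := map_fullMargin_eq_prod φ v hv (Finset.inter_subset_right (s₁ := J₁))
  rw [Finset.sdiff_inter_self_left] at eu
  rw [Finset.sdiff_inter_self_right] at ev
  have hu0 : ∀ j ∈ J₁ ∩ J₂, u j (s j) ≠ 0 :=
    Finset.prod_ne_zero_iff.1 (left_ne_zero_of_mul (eu s ▸ hs))
  have hv0 : ∀ j ∈ J₁ ∩ J₂, v j (s j) ≠ 0 :=
    Finset.prod_ne_zero_iff.1 (left_ne_zero_of_mul (ev s ▸ hs))
  -- Both ratios are the same quotient of two entries of the common margin on `J₁ ∩ J₂`.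
  have huv : ∀ c ∈ J₁ ∩ J₂, ∀ x, u c x / u c (s c) = v c x / v c (s c) := by
    intro c hc x
    have key : ∀ (w : (j : Fin n) → Fin (a j) → F) (D : F), (∀ i, φ (fullMargin K (J₁ ∩ J₂) i) =
        (∏ j ∈ J₁ ∩ J₂, w j (i j)) * D) → w c (s c) ≠ 0 → w c x / w c (s c) =
        φ (fullMargin K (J₁ ∩ J₂) (update s c x)) / φ (fullMargin K (J₁ ∩ J₂) s) := by
      intro w D hw hw0
      have he : ∏ j ∈ (J₁ ∩ J₂).erase c, w j (update s c x j) =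
          ∏ j ∈ (J₁ ∩ J₂).erase c, w j (s j) := Finset.prod_congr rfl fun j hj => by
        rw [update_of_ne (Finset.ne_of_mem_erase hj)]
      rw [div_eq_div_iff hw0 hs, hw, hw, ← Finset.mul_prod_erase _ _ hc,
        ← Finset.mul_prod_erase _ (fun j => w j (update s c x j)) hc, update_self, he]
      ring
    rw [key u _ eu (hu0 c hc), key v _ ev (hv0 c hc)]
  let U := ∏ j ∈ J₁ ∩ J₂, u j (s j)
  let V := ∏ j ∈ J₁ ∩ J₂, v j (s j)
  -- On the intersection the vectors are normalised to `1` at `s`; the scalars `U` and `V` lost this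
  -- way are put into `d₁` and `d₂`. Both products of sums then equal the margin entry at `s`.
  let w : (j : Fin n) → Fin (a j) → F := fun j x =>
    if j ∈ J₁ then if j ∈ J₂ then u j x / u j (s j) else (if j = d₁ then U else 1) * u j x
    else (if j = d₂ then V else 1) * v j x
  have wC : ∀ j ∈ J₁ ∩ J₂, ∀ x, w j x = u j x / u j (s j) := fun j hj x => by
    rw [Finset.mem_inter] at hj; simp [w, hj.1, hj.2]
  have w1 : ∀ j ∈ J₁ \ J₂, ∀ x, w j x = (if j = d₁ then U else 1) * u j x := fun j hj x => by
    rw [Finset.mem_sdiff] at hj; simp [w, hj.1, hj.2]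
  have w2 : ∀ j ∈ J₂ \ J₁, ∀ x, w j x = (if j = d₂ then V else 1) * v j x := fun j hj x => by
    rw [Finset.mem_sdiff] at hj; simp [w, hj.2]
  have s1 : ∏ j ∈ J₁ \ J₂, ∑ x, w j x = φ (fullMargin K (J₁ ∩ J₂) s) := by
    rw [eu s, ← prod_ite_eq_mul hd₁]
    exact Finset.prod_congr rfl fun j hj => by
      rw [Finset.mul_sum]; exact Finset.sum_congr rfl fun x _ => w1 j hj x
  have s2 : ∏ j ∈ J₂ \ J₁, ∑ x, w j x = φ (fullMargin K (J₁ ∩ J₂) s) := by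
    rw [ev s, ← prod_ite_eq_mul hd₂]
    exact Finset.prod_congr rfl fun j hj => by
      rw [Finset.mul_sum]; exact Finset.sum_congr rfl fun x _ => w2 j hj x
  refine ⟨w, fun i => ?_, fun i => ?_, s1.trans s2.symm, s1 ▸ hs⟩
  · rw [hu, ← Finset.prod_inter_mul_prod_sdiff J₁ J₂ fun j => u j (i j),
      ← Finset.prod_inter_mul_prod_sdiff J₁ J₂ fun j => w j (i j),
      Finset.prod_congr rfl fun j hj => w1 j hj (i j), prod_ite_eq_mul hd₁,
      Finset.prod_congr rfl fun j hj => wC j hj (i j), Finset.prod_div_distrib, ← mul_assoc,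
      div_mul_cancel₀ _ (Finset.prod_ne_zero_iff.2 hu0)]
  · rw [hv, ← Finset.prod_inter_mul_prod_sdiff J₂ J₁ fun j => v j (i j),
      ← Finset.prod_inter_mul_prod_sdiff J₂ J₁ fun j => w j (i j), Finset.inter_comm J₂ J₁,
      Finset.prod_congr rfl fun j hj => w2 j hj (i j), prod_ite_eq_mul hd₂,
      Finset.prod_congr rfl fun j hj => (wC j hj (i j)).trans (huv j hj (i j)),
      Finset.prod_div_distrib, ← mul_assoc, div_mul_cancel₀ _ (Finset.prod_ne_zero_iff.2 hv0)]

theorem eq_zero_of_sum_eq_zero {F : Type*} [AddCommMonoid F] {m : ℕ} (hm : m < 2)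
    {u : Fin m → F} (hu : ∑ v, u v = 0) (x : Fin m) : u x = 0 := by
  have : Subsingleton (Fin m) := Fin.subsingleton_iff_le_one.2 (by omega)
  rwa [Fintype.sum_subsingleton u x] at hu

/-- If `a` is `1` in the directions `i₁`, `i₂` or in all directions of `J₁ ∩ J₂`, two product
tables with vanishing margin on `J₁ ∩ J₂` are parametrized by a single family of vectors. -/
theorem exists_common_family_of_sum_eq_zero {F : Type*} [CommRing F] (ha : ∀ j, 1 ≤ a j)
    {i₁ i₂ : Fin n} (hi₁ : i₁ ∈ J₁ \ J₂) (hi₂ : i₂ ∈ J₂ \ J₁)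
    (hc : ¬(2 ≤ a i₁ ∧ 2 ≤ a i₂ ∧ ∃ c ∈ J₁ ∩ J₂, 2 ≤ a c)) {u v : (j : Fin n) → Fin (a j) → F}
    (hu : ∑ x, u i₁ x = 0) (hv : ∑ x, v i₂ x = 0) :
    ∃ w : (j : Fin n) → Fin (a j) → F,
      (∀ i : (j : Fin n) → Fin (a j), ∏ j ∈ J₁, u j (i j) = ∏ j ∈ J₁, w j (i j)) ∧
      (∀ i : (j : Fin n) → Fin (a j), ∏ j ∈ J₂, v j (i j) = ∏ j ∈ J₂, w j (i j)) ∧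
      ∑ x, w i₁ x = 0 ∧ ∑ x, w i₂ x = 0 := by
  obtain ⟨hi₁1, hi₁2⟩ := Finset.mem_sdiff.1 hi₁
  obtain ⟨hi₂1, hi₂2⟩ := Finset.mem_sdiff.1 hi₂
  by_cases h1 : 2 ≤ a i₁
  swap
  -- With `a i₁ = 1` the vector `u i₁` is zero, so the `J₁`-table vanishes; keeping `v` on `J₂` and
  -- `0` elsewhere reproduces both tables.
  · refine ⟨fun j x => if j ∈ J₂ then v j x else 0, fun i => ?_, fun i => ?_, ?_, ?_⟩
    · rw [Finset.prod_eq_zero hi₁1 (eq_zero_of_sum_eq_zero (by omega) hu _),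
        Finset.prod_eq_zero hi₁1 (if_neg hi₁2)]
    · exact Finset.prod_congr rfl fun j hj => (if_pos hj).symm
    · simp [hi₁2]
    · simpa [hi₂1] using hv
  by_cases h2 : 2 ≤ a i₂
  swap
  · refine ⟨fun j x => if j ∈ J₁ then u j x else 0, fun i => ?_, fun i => ?_, ?_, ?_⟩
    · exact Finset.prod_congr rfl fun j hj => (if_pos hj).symm
    · rw [Finset.prod_eq_zero hi₂1 (eq_zero_of_sum_eq_zero (by omega) hv _),
        Finset.prod_eq_zero hi₂1 (if_neg hi₂2)]
    · simpa [hi₁1] using hu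
    · simp [hi₂2]
  have hC : ∀ c ∈ J₁ ∩ J₂, ∀ x : Fin (a c), x = ⟨0, ha c⟩ := fun c hcc x => by
    have : ¬ 2 ≤ a c := fun h => hc ⟨h1, h2, c, hcc, h⟩
    ext
    have := x.2
    simp only
    omega
  let U := ∏ j ∈ J₁ ∩ J₂, u j ⟨0, ha j⟩
  let V := ∏ j ∈ J₁ ∩ J₂, v j ⟨0, ha j⟩
  -- All directions of the intersection now have size `1`, so their factors are constants, absorbed
  -- into `i₁` and `i₂`.
  let w : (j : Fin n) → Fin (a j) → F := fun j x =>
    if j ∈ J₁ then if j ∈ J₂ then 1 else (if j = i₁ then U else 1) * u j x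
    else (if j = i₂ then V else 1) * v j x
  have wC : ∀ j ∈ J₁ ∩ J₂, ∀ x, w j x = 1 := fun j hj x => by
    rw [Finset.mem_inter] at hj; simp [w, hj.1, hj.2]
  have w1 : ∀ j ∈ J₁ \ J₂, ∀ x, w j x = (if j = i₁ then U else 1) * u j x := fun j hj x => by
    rw [Finset.mem_sdiff] at hj; simp [w, hj.1, hj.2]
  have w2 : ∀ j ∈ J₂ \ J₁, ∀ x, w j x = (if j = i₂ then V else 1) * v j x := fun j hj x => by
    rw [Finset.mem_sdiff] at hj; simp [w, hj.2]
  refine ⟨w, fun i => ?_, fun i => ?_, ?_, ?_⟩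
  · rw [← Finset.prod_inter_mul_prod_sdiff J₁ J₂ fun j => u j (i j),
      ← Finset.prod_inter_mul_prod_sdiff J₁ J₂ fun j => w j (i j),
      Finset.prod_congr rfl fun j hj => w1 j hj (i j), prod_ite_eq_mul hi₁,
      Finset.prod_congr rfl fun j hj => wC j hj (i j), Finset.prod_const_one, one_mul,
      Finset.prod_congr rfl fun j hj => by rw [hC j hj (i j)]]
  · rw [← Finset.prod_inter_mul_prod_sdiff J₂ J₁ fun j => v j (i j),
      ← Finset.prod_inter_mul_prod_sdiff J₂ J₁ fun j => w j (i j), Finset.inter_comm J₂ J₁,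
      Finset.prod_congr rfl fun j hj => w2 j hj (i j), prod_ite_eq_mul hi₂,
      Finset.prod_congr rfl fun j hj => wC j hj (i j), Finset.prod_const_one, one_mul,
      Finset.prod_congr rfl fun j hj => by rw [hC j hj (i j)]]
  · rw [Finset.sum_congr rfl fun x _ => w1 i₁ hi₁ x, ← Finset.mul_sum, hu, mul_zero]
  · rw [Finset.sum_congr rfl fun x _ => w2 i₂ hi₂ x, ← Finset.mul_sum, hv, mul_zero]

/-- Every prime ideal over `I_Δ` contains `P_Δ` or one of the relevant ideals `Q_{i₁,i₂}`. -/
theorem mainIdeal_le_or_exists_twoFacetIdeal_le (ha : ∀ j, 1 ≤ a j)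
    (hmem : ∀ J, J ∈ Δ ↔ J ⊆ J₁ ∨ J ⊆ J₂) (hne₁ : (J₁ \ J₂).Nonempty) (hne₂ : (J₂ \ J₁).Nonempty)
    (q : Ideal (TableRing K a)) [q.IsPrime] (hq : independenceIdeal K a Δ ≤ q) :
    mainIdeal K a Δ ≤ q ∨ ∃ i₁ ∈ J₁ \ J₂, ∃ i₂ ∈ J₂ \ J₁,
      (2 ≤ a i₁ ∧ 2 ≤ a i₂ ∧ ∃ c ∈ J₁ ∩ J₂, 2 ≤ a c) ∧ twoFacetIdeal K a Δ J₁ J₂ i₁ i₂ ≤ q := by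
  let F := FractionRing (TableRing K a ⧸ q)
  let φ : TableRing K a →ₐ[K] F := (IsScalarTower.toAlgHom K (TableRing K a ⧸ q) F).comp
    (Ideal.Quotient.mkₐ K q)
  have hφ : RingHom.ker φ = q := by
    ext x
    rw [RingHom.mem_ker, ← Ideal.Quotient.eq_zero_iff_mem]
    exact map_eq_zero_iff _ (IsFractionRing.injective (TableRing K a ⧸ q) F)
  obtain ⟨d₁, hd₁⟩ := hne₁
  obtain ⟨d₂, hd₂⟩ := hne₂
  obtain ⟨hs₁, hs₂⟩ := (independenceIdeal_le_ker_iff ha hmem φ.toRingHom).1 (hφ.symm ▸ hq)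
  by_cases h0 : ∀ i, φ (fullMargin K (J₁ ∩ J₂) i) = 0
  swap
  · left
    push Not at h0
    obtain ⟨s, hs⟩ := h0
    obtain ⟨w, hw₁, hw₂, hN, hN0⟩ := exists_common_family φ.toRingHom hd₁ hd₂ hs₁ hs₂ hs
    rw [← hφ, mainIdeal_le_ker_iff]
    intro f hf
    exact eq_zero_of_mem_ker_sigma ha hmem hd₁ (isProductOn_comp_tau φ w J₁ hw₁)
      (isProductOn_comp_tau φ w J₂ hw₂) hN hN0 hf
  obtain ⟨i₁, hi₁, u, hu, hu0⟩ := exists_sum_eq_zero φ.toRingHom hd₁ hs₁ h0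
  obtain ⟨i₂, hi₂, v, hv, hv0⟩ := exists_sum_eq_zero φ.toRingHom hd₂ hs₂
    (by rwa [Finset.inter_comm])
  by_cases hc : 2 ≤ a i₁ ∧ 2 ≤ a i₂ ∧ ∃ c ∈ J₁ ∩ J₂, 2 ≤ a c
  · refine Or.inr ⟨i₁, hi₁, i₂, hi₂, hc, ?_⟩
    rw [← hφ]
    exact (twoFacetIdeal_le_ker_iff ha hmem φ.toRingHom i₁ i₂).2 ⟨⟨hs₁, hs₂⟩,
      map_fullMargin_erase_eq_zero φ.toRingHom (Finset.mem_sdiff.1 hi₁).1 hu hu0,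
      map_fullMargin_erase_eq_zero φ.toRingHom (Finset.mem_sdiff.1 hi₂).1 hv hv0⟩
  · left
    obtain ⟨w, hw₁, hw₂, h1, h2⟩ :=
      exists_common_family_of_sum_eq_zero ha hi₁ hi₂ hc hu0 hv0
    rw [← hφ, mainIdeal_le_ker_iff]
    intro f hf
    exact eq_zero_of_mem_ker_sigma_of_sum_eq_zero ha hmem hi₁ hi₂
      (isProductOn_comp_tau φ w J₁ fun i => (hu i).trans (hw₁ i))
      (isProductOn_comp_tau φ w J₂ fun i => (hv i).trans (hw₂ i)) h1 h2 hf

/-! ### Inclusions and non-inclusions among `I_Δ`, `P_Δ` and the `Q_{i₁,i₂}`. -/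

theorem mainIdeal_le_ker_segreMap : mainIdeal K a Δ ≤ RingHom.ker (segreMap K a) :=
  (mainIdeal_le_ker_iff _).2 fun _ hf => hf

theorem segreMap_fullMargin (J : Finset (Fin n)) (i : (j : Fin n) → Fin (a j)) :
    segreMap K a (fullMargin K J i) =
      (∏ j ∈ J, X ⟨j, i j⟩) * ∏ j ∈ Finset.univ \ J, ∑ v, X ⟨j, v⟩ :=
  map_fullMargin_eq_prod (segreMap K a).toRingHom (fun j v => X ⟨j, v⟩)
    segreMap_fullMargin_univ (Finset.subset_univ J) i

/-- The minors mixing two margins belong to `P_Δ`. -/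
theorem mixedMinor_mem_mainIdeal {J J' : Finset (Fin n)} (hJ : J ∈ Δ) (hJ' : J' ∈ Δ) {l : Fin n}
    (hl : l ∈ J) (hl' : l ∈ J') (i k : (j : Fin n) → Fin (a j)) :
    fullMargin K J i * fullMargin K J' k -
      fullMargin K J (update i l (k l)) * fullMargin K J' (update k l (i l)) ∈
        mainIdeal K a Δ := by
  let x : ∀ J ∈ Δ, ((j : Fin n) → Fin (a j)) → MarginRing K a Δ := fun J hJ i =>
    X ⟨⟨J, hJ⟩, fun j => i j⟩
  have hx : ∀ J hJ i, tau K a Δ (x J hJ i) = fullMargin K J i := fun J hJ i => by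
    simp only [x, tau, aeval_X]; rfl
  have hmem : x J hJ i * x J' hJ' k - x J hJ (update i l (k l)) * x J' hJ' (update k l (i l)) ∈
      RingHom.ker (sigma K a Δ) := by
    rw [RingHom.mem_ker, sigma]
    simp only [AlgHom.comp_apply, map_sub, map_mul, hx, segreMap_fullMargin]
    have key : ∀ (J : Finset (Fin n)) (i : (j : Fin n) → Fin (a j)) (v : Fin (a l)), l ∈ J →
        ∏ j ∈ J, (X ⟨j, update i l v j⟩ : MvPolynomial ((j : Fin n) × Fin (a j)) K) =
          X ⟨l, v⟩ * ∏ j ∈ J.erase l, X ⟨j, i j⟩ := fun J i v hl => by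
      rw [← Finset.mul_prod_erase _ _ hl, update_self]
      congr 1
      exact Finset.prod_congr rfl fun j hj => by rw [update_of_ne (Finset.ne_of_mem_erase hj)]
    have e1 := key J i (i l) hl
    have e2 := key J' k (k l) hl'
    rw [update_eq_self] at e1 e2
    rw [e1, e2, key J i _ hl, key J' k _ hl']
    ring
  have := Ideal.mem_map_of_mem (tau K a Δ) hmem
  rwa [map_sub, map_mul, map_mul, hx, hx, hx, hx] at this

theorem independenceIdeal_le_mainIdeal (ha : ∀ j, 1 ≤ a j)
    (hmem : ∀ J, J ∈ Δ ↔ J ⊆ J₁ ∨ J ⊆ J₂) : independenceIdeal K a Δ ≤ mainIdeal K a Δ := by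
  have aux : ∀ J ∈ Δ, IsSwap fun i => Ideal.Quotient.mk (mainIdeal K a Δ) (fullMargin K J i) := by
    intro J hJ l i k
    by_cases hl : l ∈ J
    · rw [← map_mul, ← map_mul, Ideal.Quotient.eq, mul_comm (fullMargin K J (update k l _))]
      exact mixedMinor_mem_mainIdeal hJ hJ hl hl i k
    · have h : ∀ (i : (j : Fin n) → Fin (a j)) v, fullMargin K J (update i l v) = fullMargin K J i :=
        fun i v => dependsOnlyOn_fullMargin J _ _ fun j hj =>
          update_of_ne (ne_of_mem_of_not_mem hj hl) _ _
      simp only [h]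
      exact mul_comm _ _
  have := (independenceIdeal_le_ker_iff ha hmem (Ideal.Quotient.mk (mainIdeal K a Δ))).2
    ⟨aux J₁ ((hmem _).2 (Or.inl le_rfl)), aux J₂ ((hmem _).2 (Or.inr le_rfl))⟩
  rwa [Ideal.mk_ker] at this

/-- The table with a single entry `1` has rank one, so `P_Δ` vanishes at it, while every margin of
it has an entry `1`. -/
theorem not_marginIdeal_le_mainIdeal (ha : ∀ j, 1 ≤ a j) (J : Finset (Fin n)) :
    ¬ marginIdeal K a J ≤ mainIdeal K a Δ := by
  intro h
  have h1 := (marginIdeal_le_ker_iff ha (segreMap K a).toRingHom J).1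
    (h.trans mainIdeal_le_ker_segreMap) fun j => ⟨0, ha j⟩
  let y : (j : Fin n) → Fin (a j) → K := fun j => Pi.single ⟨0, ha j⟩ 1
  have h2 := congrArg (MvPolynomial.eval fun p : (j : Fin n) × Fin (a j) => y p.1 p.2)
    ((segreMap_fullMargin J _).symm.trans h1)
  have hy : ∀ j, ∑ v, y j v = 1 := fun j => by simp [y]
  have hy' : ∀ j, y j ⟨0, ha j⟩ = 1 := fun j => Pi.single_eq_same _ _
  simp only [map_mul, map_prod, map_sum, MvPolynomial.eval_X, hy, hy', Finset.prod_const_one,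
    mul_one, map_zero] at h2
  exact one_ne_zero h2

/-- A family of vectors with sum `1`, except for the one in direction `d`, whose sum is `0`. -/
theorem exists_family_sum (t : (j : Fin n) → Fin (a j)) {d : Fin n} (hd : 2 ≤ a d) :
    ∃ u : (j : Fin n) → Fin (a j) → K, (∀ j ≠ d, ∑ v, u j v = 1) ∧ ∑ v, u d v = 0 ∧
      (∀ j, u j (t j) = 1) ∧ ∀ j ≠ d, ∀ x ≠ t j, u j x = 0 := by
  have : Nontrivial (Fin (a d)) := Fin.nontrivial_iff_two_le.2 hd
  obtain ⟨r, hr⟩ := exists_ne (t d)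
  let u : (j : Fin n) → Fin (a j) → K := update (fun j => Pi.single (t j) 1) d
    (Pi.single (t d) 1 - Pi.single r 1)
  have h1 : ∀ j ≠ d, u j = Pi.single (t j) 1 := fun j hj => update_of_ne hj _ _
  have h2 : u d = Pi.single (t d) 1 - Pi.single r 1 := update_self _ _ _
  refine ⟨u, fun j hj => ?_, ?_, fun j => ?_, fun j hj x hx => ?_⟩
  · rw [h1 j hj]; simp
  · rw [h2]; simp
  · by_cases hj : j = d
    · subst hj; rw [h2]; simp [hr.symm]
    · rw [h1 j hj]; simp
  · rw [h1 j hj, Pi.single_eq_of_ne hx]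

/-- A general point of the zero set of `Q_{i₁,i₂}`. -/
theorem exists_point_twoFacetIdeal (ha : ∀ j, 1 ≤ a j) (hmem : ∀ J, J ∈ Δ ↔ J ⊆ J₁ ∨ J ⊆ J₂)
    {i₁ i₂ : Fin n} (hi₁ : i₁ ∈ J₁ \ J₂) (hi₂ : i₂ ∈ J₂ \ J₁) (h₁ : 2 ≤ a i₁) (h₂ : 2 ≤ a i₂)
    {c : Fin n} (hc : c ∈ J₁ ∩ J₂) (hac : 2 ≤ a c) :
    ∃ φ : TableRing K a →ₐ[K] K, twoFacetIdeal K a Δ J₁ J₂ i₁ i₂ ≤ RingHom.ker φ ∧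
      (¬ mainIdeal K a Δ ≤ RingHom.ker φ) ∧
      (∀ J ⊆ J₁, marginIdeal K a J ≤ RingHom.ker φ → i₁ ∉ J) ∧
      ∀ J ⊆ J₂, marginIdeal K a J ≤ RingHom.ker φ → i₂ ∉ J := by
  obtain ⟨hi₁1, hi₁2⟩ := Finset.mem_sdiff.1 hi₁
  obtain ⟨hi₂1, hi₂2⟩ := Finset.mem_sdiff.1 hi₂
  obtain ⟨hc1, hc2⟩ := Finset.mem_inter.1 hc
  let o : (j : Fin n) → Fin (a j) := fun j => ⟨0, ha j⟩
  let t : (j : Fin n) → Fin (a j) := update o c ⟨1, hac⟩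
  obtain ⟨u, hu1, hu0, huo, hun⟩ := exists_family_sum (K := K) o h₁
  obtain ⟨v, hv1, hv0, hvt, hvn⟩ := exists_family_sum (K := K) t h₂
  -- A sum of two rank-one tables. Since `u i₁` and `v i₂` sum to zero, only `u` is seen by margins
  -- inside `J₁`, and only `v` by margins inside `J₂`.
  let φ : TableRing K a →ₐ[K] K := aeval fun i => ∏ j, u j (i j) + ∏ j, v j (i j)
  have hφ : ∀ J i, φ (fullMargin K J i) =
      (∏ j ∈ J, u j (i j)) * (∏ j ∈ Finset.univ \ J, ∑ x, u j x) +
        (∏ j ∈ J, v j (i j)) * ∏ j ∈ Finset.univ \ J, ∑ x, v j x := by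
    intro J i
    have aux : ∀ w : (j : Fin n) → Fin (a j) → K,
        (aeval fun i => ∏ j, w j (i j) : TableRing K a →ₐ[K] K) (fullMargin K J i) =
          (∏ j ∈ J, w j (i j)) * ∏ j ∈ Finset.univ \ J, ∑ x, w j x := fun w =>
      map_fullMargin_eq_prod (aeval fun i => ∏ j, w j (i j) : TableRing K a →ₐ[K] K).toRingHom w
        (fun i => by rw [fullMargin_univ]; exact aeval_X _ _) (Finset.subset_univ J) i
    rw [← aux u, ← aux v]
    simp only [fullMargin_eq, map_sum, φ, aeval_X, Finset.sum_add_distrib]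
  have zu : ∀ J : Finset (Fin n), i₁ ∉ J → ∏ j ∈ Finset.univ \ J, ∑ x, u j x = 0 := fun J h =>
    Finset.prod_eq_zero (by simpa using h) hu0
  have zv : ∀ J : Finset (Fin n), i₂ ∉ J → ∏ j ∈ Finset.univ \ J, ∑ x, v j x = 0 := fun J h =>
    Finset.prod_eq_zero (by simpa using h) hv0
  have ou : ∀ J : Finset (Fin n), i₁ ∈ J → ∏ j ∈ Finset.univ \ J, ∑ x, u j x = 1 := fun J h =>
    Finset.prod_eq_one fun j hj => hu1 j (ne_of_mem_of_not_mem h (Finset.mem_sdiff.1 hj).2).symm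
  have ov : ∀ J : Finset (Fin n), i₂ ∈ J → ∏ j ∈ Finset.univ \ J, ∑ x, v j x = 1 := fun J h =>
    Finset.prod_eq_one fun j hj => hv1 j (ne_of_mem_of_not_mem h (Finset.mem_sdiff.1 hj).2).symm
  have φ₁ : ∀ J ⊆ J₁, i₁ ∈ J → ∀ i, φ (fullMargin K J i) = ∏ j ∈ J, u j (i j) := fun J hJ h i => by
    rw [hφ, ou J h, zv J fun h => hi₂2 (hJ h), mul_one, mul_zero, add_zero]
  have φ₂ : ∀ J ⊆ J₂, i₂ ∈ J → ∀ i, φ (fullMargin K J i) = ∏ j ∈ J, v j (i j) := fun J hJ h i => by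
    rw [hφ, ov J h, zu J fun h => hi₁2 (hJ h), mul_one, mul_zero, zero_add]
  refine ⟨φ, (twoFacetIdeal_le_ker_iff ha hmem φ.toRingHom i₁ i₂).2 ⟨⟨?_, ?_⟩, fun i => ?_,
    fun i => ?_⟩, fun h => ?_, fun J hJ h hi => ?_, fun J hJ h hi => ?_⟩
  · have := isSwap_prod J₁ u
    rwa [← funext (φ₁ J₁ le_rfl hi₁1)] at this
  · have := isSwap_prod J₂ v
    rwa [← funext (φ₂ J₂ le_rfl hi₂1)] at this
  · refine (hφ _ i).trans ?_
    rw [zu _ (Finset.notMem_erase _ _), zv _ fun h => hi₂2 (Finset.mem_of_mem_erase h)]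
    simp
  · refine (hφ _ i).trans ?_
    rw [zv _ (Finset.notMem_erase _ _), zu _ fun h => hi₁2 (Finset.mem_of_mem_erase h)]
    simp
  -- In direction `c` the vectors `u` and `v` are concentrated at different indices, so the minor
  -- mixing the two facets takes the value `1` at this point.
  · have hz : ∏ j ∈ J₁, u j (update o c (t c) j) = 0 :=
      Finset.prod_eq_zero hc1 (hun c (ne_of_mem_of_not_mem hc2 hi₁2) _ (by simp [t, o]))
    have h3 := h (mixedMinor_mem_mainIdeal ((hmem J₁).2 (Or.inl le_rfl))
      ((hmem J₂).2 (Or.inr le_rfl)) hc1 hc2 o t)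
    rw [RingHom.mem_ker, map_sub, map_mul, map_mul, φ₁ J₁ le_rfl hi₁1, φ₁ J₁ le_rfl hi₁1,
      φ₂ J₂ le_rfl hi₂1, Finset.prod_eq_one fun j _ => huo j, Finset.prod_eq_one fun j _ => hvt j,
      hz] at h3
    simp at h3
  · have h3 := (marginIdeal_le_ker_iff ha φ.toRingHom J).1 h o
    exact one_ne_zero ((Finset.prod_eq_one fun j _ => huo j).symm.trans
      ((φ₁ J hJ hi o).symm.trans h3))
  · have h3 := (marginIdeal_le_ker_iff ha φ.toRingHom J).1 h t
    exact one_ne_zero ((Finset.prod_eq_one fun j _ => hvt j).symm.trans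
      ((φ₂ J hJ hi t).symm.trans h3))

theorem minimalPrimes_eq_of_antichain {R : Type*} [CommRing R] {I : Ideal R} {S : Set (Ideal R)}
    (hS : ∀ q ∈ S, q.IsPrime ∧ I ≤ q) (hcover : ∀ q : Ideal R, q.IsPrime → I ≤ q → ∃ p ∈ S, p ≤ q)
    (hanti : IsAntichain (· ≤ ·) S) : I.minimalPrimes = S := by
  ext q
  constructor
  · rintro ⟨⟨hq, hIq⟩, hmin⟩
    obtain ⟨p, hp, hpq⟩ := hcover q hq hIq
    rwa [hpq.antisymm (hmin (hS p hp) hpq)] at hp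
  · intro hq
    refine ⟨hS q hq, fun q' ⟨hq', hI⟩ hle => ?_⟩
    obtain ⟨p, hp, hpq⟩ := hcover q' hq' hI
    rwa [hanti.eq hp hq (hpq.trans hle)] at hpq

/-- The minimal primes over `I_Δ`, given that the candidates are prime. -/
theorem minimalPrimes_independenceIdeal (ha : ∀ j, 1 ≤ a j)
    (hmem : ∀ J, J ∈ Δ ↔ J ⊆ J₁ ∨ J ⊆ J₂) (hne₁ : (J₁ \ J₂).Nonempty) (hne₂ : (J₂ \ J₁).Nonempty)
    (hP : (mainIdeal K a Δ).IsPrime)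
    (hQ : ∀ i₁ ∈ J₁ \ J₂, ∀ i₂ ∈ J₂ \ J₁, (twoFacetIdeal K a Δ J₁ J₂ i₁ i₂).IsPrime) :
    (independenceIdeal K a Δ).minimalPrimes = {mainIdeal K a Δ} ∪
      {Q | ∃ i₁ ∈ J₁ \ J₂, ∃ i₂ ∈ J₂ \ J₁, (2 ≤ a i₁ ∧ 2 ≤ a i₂ ∧ ∃ c ∈ J₁ ∩ J₂, 2 ≤ a c) ∧
        Q = twoFacetIdeal K a Δ J₁ J₂ i₁ i₂} := by
  have hL₁ : ∀ i₁ i₂, marginIdeal K a (J₁.erase i₁) ≤ twoFacetIdeal K a Δ J₁ J₂ i₁ i₂ :=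
    fun i₁ i₂ => le_sup_right.trans (le_sup_left (b := marginIdeal K a (J₂.erase i₂)))
  have hL₂ : ∀ i₁ i₂, marginIdeal K a (J₂.erase i₂) ≤ twoFacetIdeal K a Δ J₁ J₂ i₁ i₂ :=
    fun i₁ i₂ => le_sup_right
  have hI : ∀ i₁ i₂, independenceIdeal K a Δ ≤ twoFacetIdeal K a Δ J₁ J₂ i₁ i₂ :=
    fun i₁ i₂ => le_sup_left.trans (le_sup_left (b := marginIdeal K a (J₂.erase i₂)))
  refine minimalPrimes_eq_of_antichain ?_ ?_ ?_
  · rintro q (rfl | ⟨i₁, hi₁, i₂, hi₂, -, rfl⟩)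
    · exact ⟨hP, independenceIdeal_le_mainIdeal ha hmem⟩
    · exact ⟨hQ i₁ hi₁ i₂ hi₂, hI i₁ i₂⟩
  · intro q hq hIq
    rcases mainIdeal_le_or_exists_twoFacetIdeal_le ha hmem hne₁ hne₂ q hIq with
      h | ⟨i₁, hi₁, i₂, hi₂, hc, h⟩
    · exact ⟨_, Or.inl rfl, h⟩
    · exact ⟨_, Or.inr ⟨i₁, hi₁, i₂, hi₂, hc, rfl⟩, h⟩
  · rintro p (rfl | ⟨i₁, hi₁, i₂, hi₂, ⟨h₁, h₂, c, hc, hac⟩, rfl⟩) q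
      (rfl | ⟨k₁, hk₁, k₂, hk₂, ⟨h₁', h₂', c', hc', hac'⟩, rfl⟩) hne hle
    · exact hne rfl
    · obtain ⟨φ, h, h', -⟩ := exists_point_twoFacetIdeal (K := K) ha hmem hk₁ hk₂ h₁' h₂' hc' hac'
      exact h' (hle.trans h)
    · exact not_marginIdeal_le_mainIdeal ha _ ((hL₁ i₁ i₂).trans hle)
    · obtain ⟨φ, h, -, hφ₁, hφ₂⟩ :=
        exists_point_twoFacetIdeal (K := K) ha hmem hk₁ hk₂ h₁' h₂' hc' hac'
      -- The point chosen on `Q_{k₁,k₂}` kills the margin on `J₁ \ i₁`, which forces `k₁ = i₁`;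
      -- likewise `k₂ = i₂`.
      have e₁ := hφ₁ _ (Finset.erase_subset _ _) ((hL₁ i₁ i₂).trans (hle.trans h))
      have e₂ := hφ₂ _ (Finset.erase_subset _ _) ((hL₂ i₁ i₂).trans (hle.trans h))
      simp only [Finset.mem_erase, not_and_or, not_not] at e₁ e₂
      have e₁' := e₁.resolve_right fun h => h (Finset.mem_sdiff.1 hk₁).1
      have e₂' := e₂.resolve_right fun h => h (Finset.mem_sdiff.1 hk₂).1
      exact hne (by rw [e₁', e₂'])

/-! ### Linear coordinates adapted to the margins. -/

section Support

variable (o : (j : Fin n) → Fin (a j))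

/-- The directions in which a cell differs from the base cell `o`. -/
def cellSupport (i : (j : Fin n) → Fin (a j)) : Finset (Fin n) :=
  Finset.univ.filter fun j => i j ≠ o j

theorem mem_cellSupport {i : (j : Fin n) → Fin (a j)} {j : Fin n} :
    j ∈ cellSupport o i ↔ i j ≠ o j := by simp [cellSupport]

theorem cellSupport_piecewise (J : Finset (Fin n)) (i : (j : Fin n) → Fin (a j)) :
    cellSupport o (J.piecewise i o) = cellSupport o i ∩ J := by
  ext j
  by_cases h : j ∈ J <;> simp [mem_cellSupport, h]

theorem piecewise_of_cellSupport_subset {J : Finset (Fin n)} {i : (j : Fin n) → Fin (a j)}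
    (h : cellSupport o i ⊆ J) : J.piecewise i o = i := by
  funext j
  by_cases hj : j ∈ J
  · simp [hj]
  · have : ¬ (i j ≠ o j) := fun h' => hj (h ((mem_cellSupport o).2 h'))
    simp [hj, not_not.1 this]

variable (K) in
/-- The coordinates in which the margins become subtables: the entry of the margin on the support
of a cell. -/
def supportMargin (i : (j : Fin n) → Fin (a j)) : TableRing K a :=
  fullMargin K (cellSupport o i) i

/-- Induction on the number of directions of `J` in which `i` agrees with `o`. In such a direction
`l`, the entry is the margin on `J \ l` minus the entries at the other values of `l`, and all of
these have fewer agreements. -/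
theorem fullMargin_mem_span (J : Finset (Fin n)) (i : (j : Fin n) → Fin (a j)) :
    fullMargin K J i ∈ Submodule.span K (supportMargin K o '' {k | cellSupport o k ⊆ J}) := by
  induction hm : (J \ cellSupport o i).card using Nat.strong_induction_on generalizing J i with
  | _ m ih =>
  rcases (J \ cellSupport o i).eq_empty_or_nonempty with he | ⟨l, hl⟩
  · have h1 : cellSupport o (J.piecewise i o) = J := by
      rw [cellSupport_piecewise, Finset.inter_eq_right]
      exact Finset.sdiff_eq_empty_iff_subset.1 he
    have h2 : fullMargin K J i = supportMargin K o (J.piecewise i o) := by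
      rw [supportMargin, h1]
      exact dependsOnlyOn_fullMargin J _ _ fun j hj => by simp [hj]
    rw [h2]
    exact Submodule.subset_span ⟨_, h1.le, rfl⟩
  · obtain ⟨hlJ, hli⟩ := Finset.mem_sdiff.1 hl
    rw [mem_cellSupport, not_not] at hli
    have h1 := fullMargin_eq_sum (K := K) (Finset.notMem_erase l J) i
    rw [Finset.insert_erase hlJ, ← Finset.add_sum_erase _ _ (Finset.mem_univ (o l)), ← hli,
      update_eq_self, ← sub_eq_iff_eq_add] at h1
    rw [← h1]
    refine Submodule.sub_mem _ ?_ (Submodule.sum_mem _ fun v hv => ?_)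
    · refine Submodule.span_mono ?_ (ih _ ?_ (J.erase l) i rfl)
      · exact Set.image_mono fun k hk => Finset.Subset.trans hk (Finset.erase_subset _ _)
      · rw [← hm, Finset.erase_sdiff_comm]
        exact Finset.card_erase_lt_of_mem hl
    · refine ih _ ?_ J _ rfl
      rw [← hm]
      refine Finset.card_lt_card (Finset.ssubset_iff_of_subset ?_ |>.2 ⟨l, hl, ?_⟩)
      · intro j hj
        rw [Finset.mem_sdiff, mem_cellSupport, not_not] at hj ⊢
        by_cases hjl : j = l
        · subst hjl; exact ⟨hj.1, hli⟩
        · rw [update_of_ne hjl] at hj; exact hj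
      · rw [Finset.mem_sdiff, mem_cellSupport, not_and, not_not, update_self, ← hli]
        exact fun _ => Finset.ne_of_mem_erase hv

variable (K) in
/-- The linear change of coordinates to the entries `supportMargin`. -/
def coordChange : TableRing K a →ₐ[K] TableRing K a := aeval (supportMargin K o)

theorem coordChange_X (i : (j : Fin n) → Fin (a j)) :
    coordChange K o (X i) = supportMargin K o i := aeval_X _ _

theorem coordChange_surjective : Surjective (coordChange K o) := by
  rw [← AlgHom.range_eq_top, eq_top_iff, ← MvPolynomial.adjoin_range_X, Algebra.adjoin_le_iff]
  rintro _ ⟨i, rfl⟩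
  have h := fullMargin_mem_span (K := K) o Finset.univ i
  rw [fullMargin_univ] at h
  refine (Submodule.span_le (p := Subalgebra.toSubmodule (coordChange K o).range)).2 ?_ h
  rintro _ ⟨k, -, rfl⟩
  exact ⟨X k, coordChange_X o k⟩

variable (K) in
/-- The change of coordinates as an automorphism. -/
def coordEquiv : TableRing K a ≃ₐ[K] TableRing K a :=
  AlgEquiv.ofBijective (coordChange K o)
    ⟨injective_of_surjective_ringEnd (coordChange K o).toRingHom (coordChange_surjective o),
      coordChange_surjective o⟩

theorem coordEquiv_X (i : (j : Fin n) → Fin (a j)) :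
    coordEquiv K o (X i) = supportMargin K o i := coordChange_X o i

end Support

/-! ### Primality of `P_Δ`. -/

/-- Applied in both directions, this shows that `P_Δ` depends only on the image of `τ_Δ`, so
redundant generators of that image can be discarded. -/
theorem map_ker_le_map_ker {A B C D : Type*} [CommRing A] [CommRing B] [CommRing C] [CommRing D]
    (s : C →+* D) (f : A →+* C) (g : B →+* C) (h : ∀ x, ∃ y, g y = f x) :
    (RingHom.ker (s.comp f)).map f ≤ (RingHom.ker (s.comp g)).map g := by
  rw [Ideal.map_le_iff_le_comap]
  intro x hx
  obtain ⟨y, hy⟩ := h x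
  rw [Ideal.mem_comap, ← hy]
  refine Ideal.mem_map_of_mem g ?_
  rw [RingHom.mem_ker, RingHom.comp_apply] at hx ⊢
  rw [hy, hx]

/-- The extension of the kernel of a map to a domain along the inclusion of a polynomial subring is
prime. -/
theorem isPrime_map_rename_ker {σ D : Type*} [CommRing D] [IsDomain D] (p : σ → Prop)
    (f : MvPolynomial {i // p i} K →+* D) :
    ((RingHom.ker f).map (rename (Subtype.val : {i // p i} → σ) : _ →ₐ[K] _).toRingHom).IsPrime := by
  classical
  -- Over the subring, the big ring is a polynomial ring in the remaining variables; the extended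
  -- ideal is the kernel of applying `f` to coefficients, with values in a polynomial ring over the
  -- domain `D`.
  let e : MvPolynomial σ K ≃ₐ[K] MvPolynomial {i // ¬ p i} (MvPolynomial {i // p i} K) :=
    (renameEquiv K ((Equiv.sumCompl p).symm.trans (Equiv.sumComm _ _))).trans
      (sumAlgEquiv K {i // ¬ p i} {i // p i})
  have he : e.toAlgHom.toRingHom.comp (rename (Subtype.val : {i // p i} → σ) : _ →ₐ[K] _).toRingHom
      = C := by
    refine MvPolynomial.ringHom_ext (fun r => ?_) fun i => ?_
    · simp [e]
    · simp [e, Equiv.sumCompl_symm_apply_of_pos i.2]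
  have h1 : ((RingHom.ker f).map (C : _ →+* MvPolynomial {i // ¬ p i} _)).IsPrime := by
    rw [← MvPolynomial.ker_map]
    exact RingHom.ker_isPrime _
  rw [← he, ← Ideal.map_map] at h1
  have h2 := Ideal.comap_isPrime e.toAlgHom.toRingHom
    (Ideal.map e.toAlgHom.toRingHom ((RingHom.ker f).map
      (rename (Subtype.val : {i // p i} → σ) : _ →ₐ[K] _).toRingHom)) (H := h1)
  rwa [Ideal.comap_map_of_bijective e.toAlgHom.toRingHom e.bijective] at h2

/-- The image of `τ_Δ` is the polynomial subring on the new coordinates with support in `Δ`. So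
`P_Δ` is extended from the kernel of a map of this subring to a domain. -/
theorem mainIdeal_isPrime (ha : ∀ j, 1 ≤ a j) (hmem : ∀ J, J ∈ Δ ↔ J ⊆ J₁ ∨ J ⊆ J₂) :
    (mainIdeal K a Δ).IsPrime := by
  let o : (j : Fin n) → Fin (a j) := fun j => ⟨0, ha j⟩
  let p : ((j : Fin n) → Fin (a j)) → Prop := fun i => cellSupport o i ∈ Δ
  let r : MvPolynomial {i // p i} K →ₐ[K] TableRing K a := rename Subtype.val
  let g : MvPolynomial {i // p i} K →ₐ[K] TableRing K a := (coordEquiv K o).toAlgHom.comp r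
  have hgX : ∀ i, g (X i) = supportMargin K o i.1 := fun i => by
    simp only [g, r, AlgHom.comp_apply, rename_X]; exact coordEquiv_X o i.1
  have hrange : (tau K a Δ).range = g.range := by
    refine le_antisymm ?_ ?_
    · rw [← Algebra.map_top, ← MvPolynomial.adjoin_range_X, AlgHom.map_adjoin,
        Algebra.adjoin_le_iff]
      rintro _ ⟨_, ⟨⟨⟨J, hJ⟩, s⟩, rfl⟩, rfl⟩
      obtain ⟨i, rfl⟩ := exists_restrict ha s
      have : tau K a Δ (X ⟨⟨J, hJ⟩, fun j => i j⟩) = fullMargin K J i := by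
        rw [tau, aeval_X]; rfl
      change tau K a Δ (X ⟨⟨J, hJ⟩, fun j => i j⟩) ∈ g.range
      rw [this]
      refine (Submodule.span_le (p := Subalgebra.toSubmodule g.range)).2 ?_
        (fullMargin_mem_span o J i)
      rintro _ ⟨k, hk, rfl⟩
      refine ⟨X ⟨k, ?_⟩, hgX _⟩
      exact (hmem _).2 (((hmem J).1 hJ).imp hk.trans hk.trans)
    · rw [← Algebra.map_top, ← MvPolynomial.adjoin_range_X, AlgHom.map_adjoin,
        Algebra.adjoin_le_iff]
      rintro _ ⟨_, ⟨i, rfl⟩, rfl⟩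
      refine ⟨X ⟨⟨cellSupport o i.1, i.2⟩, fun j => i.1 j⟩, ?_⟩
      change tau K a Δ _ = g (X i)
      rw [hgX, tau, aeval_X]; rfl
  have h1 : mainIdeal K a Δ =
      (RingHom.ker ((segreMap K a).toRingHom.comp g.toRingHom)).map g.toRingHom := by
    refine le_antisymm ?_ ?_
    · exact map_ker_le_map_ker (segreMap K a).toRingHom (tau K a Δ).toRingHom g.toRingHom
        fun x => (hrange ▸ ⟨x, rfl⟩ : tau K a Δ x ∈ g.range)
    · exact map_ker_le_map_ker (segreMap K a).toRingHom g.toRingHom (tau K a Δ).toRingHom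
        fun x => (hrange ▸ ⟨x, rfl⟩ : g x ∈ (tau K a Δ).range)
  have h3 := isPrime_map_rename_ker p ((segreMap K a).toRingHom.comp g.toRingHom)
  have h4 := @Ideal.map_isPrime_of_equiv _ _ _ _ _ _ _ (coordEquiv K o) _ h3
  rw [h1]
  exact (Ideal.map_map r.toRingHom (coordEquiv K o).toAlgHom.toRingHom).symm ▸ h4

/-! ### Exchange relations in the new coordinates and primality of `Q_{i₁,i₂}`. -/

/-- Replacing the entry at `o` by the sum along direction `j` is an invertible linear change in that
direction; `IsSwap.transform` applies to the matrix and to its inverse. -/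
theorem isSwap_iff_of_partialSum {ι : Type*} [DecidableEq ι] {β : ι → Type*} {R : Type*}
    [CommRing R] {b b' : ((j : ι) → β j) → R} (j : ι) [Fintype (β j)] [DecidableEq (β j)] (o : β j)
    (h : ∀ i, b' i = if i j = o then ∑ x, b (update i j x) else b i) : IsSwap b ↔ IsSwap b' := by
  constructor
  · refine fun hb => hb.transform j (fun v x => if v = o then 1 else if x = v then 1 else 0)
      fun i => ?_
    rw [h]
    split_ifs with hi
    · simp
    · simp
  · refine fun hb => hb.transform j
      (fun v x => if v = o then if x = o then 1 else -1 else if x = v then 1 else 0) fun i => ?_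
    by_cases hi : i j = o
    · have e1 : ∀ x ∈ Finset.univ.erase o,
          (if i j = o then if x = o then (1 : R) else -1 else if x = i j then 1 else 0) *
            b' (update i j x) = - b (update i j x) := fun x hx => by
        have hx' := Finset.ne_of_mem_erase hx
        rw [if_pos hi, if_neg hx', h, update_self, if_neg hx', neg_one_mul]
      rw [← Finset.add_sum_erase _ _ (Finset.mem_univ o), Finset.sum_congr rfl e1, if_pos hi,
        if_pos rfl, one_mul, h, update_self, if_pos rfl, ← Finset.add_sum_erase _ _
        (Finset.mem_univ o), Finset.sum_neg_distrib]
      simp only [update_idem]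
      rw [← hi, update_eq_self]
      ring
    · simp only [if_neg hi, ite_mul, one_mul, zero_mul, Finset.sum_ite_eq', Finset.mem_univ, if_true,
        update_eq_self, h]

section Support

variable (o : (j : Fin n) → Fin (a j))

theorem supportMargin_piecewise (J : Finset (Fin n)) (i : (j : Fin n) → Fin (a j)) :
    supportMargin K o (J.piecewise i o) = fullMargin K (J \ (Finset.univ \ cellSupport o i)) i := by
  have h : J \ (Finset.univ \ cellSupport o i) = cellSupport o i ∩ J := by
    ext j; simp [and_comm]
  rw [supportMargin, cellSupport_piecewise, h]
  exact dependsOnlyOn_fullMargin _ _ _ fun j hj => by simp [(Finset.mem_inter.1 hj).2]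

/-- The exchange relations for a margin can be checked in the new coordinates. -/
theorem isSwap_fullMargin_iff {B : Type*} [CommRing B] (φ : TableRing K a →+* B)
    (J : Finset (Fin n)) : (IsSwap fun i => φ (fullMargin K J i)) ↔
      IsSwap fun i => φ (supportMargin K o (J.piecewise i o)) := by
  -- `E` collects the directions already changed: in those where `i` agrees with `o`, the entry has
  -- been summed out.
  have key : ∀ E : Finset (Fin n), (IsSwap fun i => φ (fullMargin K J i)) ↔
      IsSwap fun i => φ (fullMargin K (J \ (E \ cellSupport o i)) i) := by
    intro E
    induction E using Finset.induction_on with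
    | empty => simp
    | insert j E hj ih =>
      rw [ih]
      by_cases hjJ : j ∈ J
      · refine isSwap_iff_of_partialSum j (o j) fun i => ?_
        split_ifs with hi
        · have hjs : j ∉ cellSupport o i := by rw [mem_cellSupport, not_not]; exact hi
          rw [fullMargin_eq_sum (l := j) (by simp [hjs]), map_sum]
          refine Finset.sum_congr rfl fun x _ => ?_
          congr 2
          ext k
          by_cases hk : k = j
          · subst hk; simp [hjJ, hj]
          · simp [hk, mem_cellSupport]
        · have hjs : j ∈ cellSupport o i := (mem_cellSupport o).2 hi
          rw [Finset.insert_sdiff_of_mem _ hjs]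
      · have : ∀ i : (j : Fin n) → Fin (a j), J \ (insert j E \ cellSupport o i) =
            J \ (E \ cellSupport o i) := fun i => by
          ext k
          by_cases hk : k = j
          · subst hk; simp [hjJ]
          · simp [hk]
        simp only [this]
  rw [key Finset.univ]
  simp only [supportMargin_piecewise]

end Support

/-- If the images of the variables under `z` are monomials or zero, then the kernel of the
substitution is controlled by the coincidences between the images of the monomials. -/
theorem eq_zero_of_aeval_eq_zero {σ τ B : Type*} [CommRing B] [Algebra K B]
    (z : σ → MvPolynomial τ K) (e : σ → τ →₀ ℕ) (hz : ∀ i, z i ≠ 0 → z i = monomial (e i) 1)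
    (χ : MvPolynomial σ K →ₐ[K] B) (h0 : ∀ i, z i = 0 → χ (X i) = 0)
    (h1 : ∀ m m' : Multiset σ, (∀ i ∈ m, z i ≠ 0) → (∀ i ∈ m', z i ≠ 0) →
      (m.map e).sum = (m'.map e).sum →
        (m.map fun i => χ (X i)).prod = (m'.map fun i => χ (X i)).prod)
    {f : MvPolynomial σ K} (hf : aeval z f = 0) : χ f = 0 := by
  classical
  -- A linear map with `ψ ∘ aeval z = χ`, defined on monomials through a chosen preimage; `h1` makes
  -- the choice irrelevant, and monomials that are not attained may go to `0`.
  let ψ : MvPolynomial τ K →ₗ[K] B := (basisMonomials τ K).constr K fun d =>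
    if h : ∃ m : Multiset σ, (∀ i ∈ m, z i ≠ 0) ∧ (m.map e).sum = d then
      (h.choose.map fun i => χ (X i)).prod else 0
  have hψ : ψ.comp (aeval z : MvPolynomial σ K →ₐ[K] _).toLinearMap = χ.toLinearMap := by
    refine (basisMonomials σ K).ext fun s => ?_
    have hs : basisMonomials σ K s = ((Finsupp.toMultiset s).map X).prod := by
      rw [coe_basisMonomials]
      change monomial s (1 : K) = _
      rw [monomial_eq, C_1, one_mul, Finsupp.toMultiset_map,
        Finsupp.prod_toMultiset, Finsupp.prod_mapDomain_index (by simp) (by simp [pow_add])]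
    rw [hs]
    generalize Finsupp.toMultiset s = m
    rw [LinearMap.comp_apply, AlgHom.toLinearMap_apply, AlgHom.toLinearMap_apply,
      map_multiset_prod (aeval z : MvPolynomial σ K →ₐ[K] _), map_multiset_prod χ,
      Multiset.map_map, Multiset.map_map]
    simp only [comp_def, aeval_X]
    change ψ (m.map fun i => z i).prod = (m.map fun i => χ (X i)).prod
    by_cases hm : ∀ i ∈ m, z i ≠ 0
    · have e1 : (m.map fun i => z i).prod = monomial (m.map e).sum 1 := by
        clear hs
        induction m using Multiset.induction_on with
        | empty => simp
        | cons i m ih =>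
          rw [Multiset.map_cons, Multiset.prod_cons, Multiset.map_cons, Multiset.sum_cons,
            ih fun k hk => hm k (Multiset.mem_cons_of_mem hk), hz i (hm i (Multiset.mem_cons_self i m)),
            monomial_mul, one_mul]
      have hex : ∃ m' : Multiset σ, (∀ i ∈ m', z i ≠ 0) ∧ (m'.map e).sum = (m.map e).sum :=
        ⟨m, hm, rfl⟩
      have e2 : ψ (monomial (m.map e).sum 1) = (hex.choose.map fun i => χ (X i)).prod := by
        have := (basisMonomials τ K).constr_basis K (fun d =>
          if h : ∃ m : Multiset σ, (∀ i ∈ m, z i ≠ 0) ∧ (m.map e).sum = d then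
            (h.choose.map fun i => χ (X i)).prod else 0) (m.map e).sum
        rw [coe_basisMonomials, dif_pos hex] at this
        exact this
      rw [e1, e2]
      exact h1 _ _ hex.choose_spec.1 hm hex.choose_spec.2
    · push Not at hm
      obtain ⟨i, hi, hzi⟩ := hm
      rw [Multiset.prod_eq_zero (Multiset.mem_map.2 ⟨i, hi, hzi⟩), map_zero,
        Multiset.prod_eq_zero (Multiset.mem_map.2 ⟨i, hi, h0 i hzi⟩)]
  have := congrArg (fun l => l f) hψ
  simp only [LinearMap.comp_apply, AlgHom.toLinearMap_apply, hf, map_zero] at this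
  exact this.symm

/-- Reads the marginal multiplicities of a product of variables off the exponents of its monomial
image. -/
theorem sum_map_apply_eq_count {σ τ γ : Type*} [DecidableEq γ] (p : σ → Prop) [DecidablePred p]
    (q : σ → γ) (v : γ) (e : σ → τ →₀ ℕ) (x : τ) (h : ∀ i, e i x = if p i ∧ q i = v then 1 else 0)
    (m : Multiset σ) : (m.map e).sum x = ((m.filter p).map q).count v := by
  induction m using Multiset.induction_on with
  | empty => simp
  | cons i m ih =>
    rw [Multiset.map_cons, Multiset.sum_cons, Finsupp.add_apply, ih, h]
    by_cases hp : p i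
    · rw [Multiset.filter_cons_of_pos _ hp, Multiset.map_cons, Multiset.count_cons, add_comm]
      simp [hp, eq_comm]
    · rw [Multiset.filter_cons_of_neg _ hp]
      simp [hp]

/-- Products of variables supported on `J` are determined by the marginals in the directions
of `J`. -/
theorem prod_eq_prod_of_cellSupport_subset {B : Type*} [CommRing B]
    (o : (j : Fin n) → Fin (a j)) {J : Finset (Fin n)} (hJ : J.Nonempty)
    {b : ((j : Fin n) → Fin (a j)) → B} (hb : IsSwap fun i => b (J.piecewise i o))
    {m m' : Multiset ((j : Fin n) → Fin (a j))} (hm : ∀ i ∈ m, cellSupport o i ⊆ J)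
    (hm' : ∀ i ∈ m', cellSupport o i ⊆ J)
    (h : ∀ j ∈ J, m.map (fun k => k j) = m'.map fun k => k j) :
    (m.map b).prod = (m'.map b).prod := by
  obtain ⟨d, hd⟩ := hJ
  have : Nonempty (Fin n) := ⟨d⟩
  have hcard : m.card = m'.card := by simpa using congrArg Multiset.card (h d hd)
  have h1 : ∀ m : Multiset ((j : Fin n) → Fin (a j)), (∀ i ∈ m, cellSupport o i ⊆ J) →
      m.map b = m.map fun i => b (J.piecewise i o) := fun m hm =>
    Multiset.map_congr rfl fun i hi => by rw [piecewise_of_cellSupport_subset o (hm i hi)]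
  have h2 : ∀ m : Multiset ((j : Fin n) → Fin (a j)), (∀ i ∈ m, cellSupport o i ⊆ J) →
      ∀ j ∉ J, m.map (fun k => k j) = Multiset.replicate m.card (o j) := fun m hm j hj => by
    rw [← Multiset.map_const' m (o j)]
    refine Multiset.map_congr rfl fun i hi => ?_
    by_contra hne
    exact hj (hm i hi ((mem_cellSupport o).2 hne))
  rw [h1 m hm, h1 m' hm']
  refine hb.prod_eq_prod m m' fun j => ?_
  by_cases hj : j ∈ J
  · exact h j hj
  · rw [h2 m hm j hj, h2 m' hm' j hj, hcard]

theorem sum_single_apply {τ : Type*} {f : (j : Fin n) × Fin (a j) → τ} (hf : Injective f)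
    {J : Finset (Fin n)} {j : Fin n} (hj : j ∈ J) (i : (j : Fin n) → Fin (a j)) (v : Fin (a j)) :
    (∑ k ∈ J, Finsupp.single (f ⟨k, i k⟩) 1 : τ →₀ ℕ) (f ⟨j, v⟩) = if i j = v then 1 else 0 := by
  classical
  rw [Finsupp.finsetSum_apply, Finset.sum_eq_single_of_mem j hj fun k _ hk => ?_]
  · simp [Finsupp.single_apply, hf.eq_iff]
  · rw [Finsupp.single_apply, if_neg]
    exact fun h => hk (congrArg Sigma.fst (hf h))

theorem sum_single_apply_of_ne {τ γ : Type*} (J : Finset γ) (f : γ → τ) {x : τ}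
    (hf : ∀ k, f k ≠ x) : (∑ k ∈ J, Finsupp.single (f k) 1 : τ →₀ ℕ) x = 0 := by
  classical
  rw [Finsupp.finsetSum_apply]
  exact Finset.sum_eq_zero fun k _ => by rw [Finsupp.single_apply, if_neg (hf k)]

/-- In the new coordinates the generators separate: coordinates supported in `J₁` form a rank-one
table that vanishes where the `i₁`-index is `o i₁`, similarly for `J₂` and `i₂`, and the rest are
free. Hence `Q` is the kernel of the map `Φ` to a polynomial ring. -/
theorem twoFacetIdeal_isPrime (ha : ∀ j, 1 ≤ a j) (hmem : ∀ J, J ∈ Δ ↔ J ⊆ J₁ ∨ J ⊆ J₂)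
    {i₁ i₂ : Fin n} (hi₁ : i₁ ∈ J₁ \ J₂) (hi₂ : i₂ ∈ J₂ \ J₁) :
    (twoFacetIdeal K a Δ J₁ J₂ i₁ i₂).IsPrime := by
  classical
  obtain ⟨hi₁1, hi₁2⟩ := Finset.mem_sdiff.1 hi₁
  obtain ⟨hi₂1, hi₂2⟩ := Finset.mem_sdiff.1 hi₂
  set Q := twoFacetIdeal K a Δ J₁ J₂ i₁ i₂
  let o : (j : Fin n) → Fin (a j) := fun j => ⟨0, ha j⟩
  let Y := (j : Fin n) × Fin (a j)
  let τ := (Y ⊕ Y) ⊕ ((j : Fin n) → Fin (a j))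
  let w₁ : (j : Fin n) → Fin (a j) → MvPolynomial τ K := fun j v =>
    if j = i₁ ∧ v = o j then 0 else X (Sum.inl (Sum.inl ⟨j, v⟩))
  let w₂ : (j : Fin n) → Fin (a j) → MvPolynomial τ K := fun j v =>
    if j = i₂ ∧ v = o j then 0 else X (Sum.inl (Sum.inr ⟨j, v⟩))
  have w₁o : w₁ i₁ (o i₁) = 0 := if_pos ⟨rfl, rfl⟩
  have w₂o : w₂ i₂ (o i₂) = 0 := if_pos ⟨rfl, rfl⟩
  -- The order of the cases is immaterial: a cell supported in `J₁ ∩ J₂` has `o` in directions `i₁`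
  -- and `i₂`, so both products vanish there (`z₂`).
  let z : ((j : Fin n) → Fin (a j)) → MvPolynomial τ K := fun i =>
    if cellSupport o i ⊆ J₁ then ∏ j ∈ J₁, w₁ j (i j)
    else if cellSupport o i ⊆ J₂ then ∏ j ∈ J₂, w₂ j (i j) else X (Sum.inr i)
  have eq_o : ∀ {i : (j : Fin n) → Fin (a j)} {J j}, cellSupport o i ⊆ J → j ∉ J → i j = o j :=
    fun {i J j} h hj => by
      by_contra hne
      exact hj (h ((mem_cellSupport o).2 hne))
  have z₁ : ∀ i, cellSupport o i ⊆ J₁ → z i = ∏ j ∈ J₁, w₁ j (i j) := fun i h => if_pos h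
  have z₂ : ∀ i, cellSupport o i ⊆ J₂ → z i = ∏ j ∈ J₂, w₂ j (i j) := fun i h => by
    by_cases h' : cellSupport o i ⊆ J₁
    · rw [z₁ i h', Finset.prod_eq_zero hi₁1 (by rw [eq_o h hi₁2, w₁o]),
        Finset.prod_eq_zero hi₂1 (by rw [eq_o h' hi₂2, w₂o])]
    · simp only [z, if_neg h', if_pos h]
  have zp₁ : ∀ i, z (J₁.piecewise i o) = ∏ j ∈ J₁, w₁ j (i j) := fun i => by
    rw [z₁ _ (by rw [cellSupport_piecewise]; exact Finset.inter_subset_right)]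
    exact Finset.prod_congr rfl fun j hj => by simp [hj]
  have zp₂ : ∀ i, z (J₂.piecewise i o) = ∏ j ∈ J₂, w₂ j (i j) := fun i => by
    rw [z₂ _ (by rw [cellSupport_piecewise]; exact Finset.inter_subset_right)]
    exact Finset.prod_congr rfl fun j hj => by simp [hj]
  let Φ : TableRing K a →ₐ[K] MvPolynomial τ K :=
    (aeval z).comp (coordEquiv K o).symm.toAlgHom
  have hΦ : ∀ i, Φ (supportMargin K o i) = z i := fun i => by
    rw [← coordEquiv_X]
    simp [Φ]
  have hΦ0 : ∀ J, (∀ k, cellSupport o k ⊆ J → z k = 0) → ∀ i, Φ (fullMargin K J i) = 0 := by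
    intro J hJ i
    refine (Submodule.span_le (p := LinearMap.ker Φ.toLinearMap)).2 ?_
      (fullMargin_mem_span (K := K) o J i)
    rintro _ ⟨k, hk, rfl⟩
    exact (hΦ k).trans (hJ k hk)
  have hle : Q ≤ RingHom.ker Φ := by
    refine (twoFacetIdeal_le_ker_iff ha hmem Φ.toRingHom i₁ i₂).2 ⟨⟨?_, ?_⟩, ?_, ?_⟩
    · rw [isSwap_fullMargin_iff o]
      have h : (fun i => Φ (supportMargin K o (J₁.piecewise i o))) =
          fun i => ∏ j ∈ J₁, w₁ j (i j) := funext fun i => by rw [hΦ, zp₁]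
      exact h ▸ isSwap_prod J₁ w₁
    · rw [isSwap_fullMargin_iff o]
      have h : (fun i => Φ (supportMargin K o (J₂.piecewise i o))) =
          fun i => ∏ j ∈ J₂, w₂ j (i j) := funext fun i => by rw [hΦ, zp₂]
      exact h ▸ isSwap_prod J₂ w₂
    · refine hΦ0 _ fun k hk => ?_
      rw [z₁ k (hk.trans (Finset.erase_subset _ _)),
        Finset.prod_eq_zero hi₁1 (by rw [eq_o hk (Finset.notMem_erase _ _), w₁o])]
    · refine hΦ0 _ fun k hk => ?_
      rw [z₂ k (hk.trans (Finset.erase_subset _ _)),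
        Finset.prod_eq_zero hi₂1 (by rw [eq_o hk (Finset.notMem_erase _ _), w₂o])]
  let χ : TableRing K a →ₐ[K] TableRing K a ⧸ Q :=
    (Ideal.Quotient.mkₐ K Q).comp (coordEquiv K o).toAlgHom
  have hχ : ∀ i, χ (X i) = Ideal.Quotient.mk Q (supportMargin K o i) := fun i => by
    rw [← coordEquiv_X]; rfl
  have hker := (twoFacetIdeal_le_ker_iff (Δ := Δ) (J₁ := J₁) (J₂ := J₂) ha hmem
    (Ideal.Quotient.mk Q) i₁ i₂).1 (by rw [Ideal.mk_ker])
  obtain ⟨⟨hs₁, hs₂⟩, hL₁, hL₂⟩ := hker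
  rw [isSwap_fullMargin_iff o] at hs₁ hs₂
  simp only [← hχ] at hs₁ hs₂
  let e : ((j : Fin n) → Fin (a j)) → τ →₀ ℕ := fun i =>
    if cellSupport o i ⊆ J₁ then ∑ j ∈ J₁, Finsupp.single (Sum.inl (Sum.inl ⟨j, i j⟩)) 1
    else if cellSupport o i ⊆ J₂ then ∑ j ∈ J₂, Finsupp.single (Sum.inl (Sum.inr ⟨j, i j⟩)) 1
    else Finsupp.single (Sum.inr i) 1
  have hz : ∀ i, z i ≠ 0 → z i = monomial (e i) 1 := by
    intro i hi
    by_cases h₁ : cellSupport o i ⊆ J₁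
    · rw [z₁ i h₁] at hi ⊢
      simp only [e, if_pos h₁]
      rw [monomial_sum_one]
      refine Finset.prod_congr rfl fun j hj => ?_
      have := Finset.prod_ne_zero_iff.1 hi j hj
      simp only [w₁, ne_eq, ite_eq_left_iff, not_forall] at this ⊢
      obtain ⟨h, -⟩ := this
      rw [if_neg h]; rfl
    by_cases h₂ : cellSupport o i ⊆ J₂
    · rw [z₂ i h₂] at hi ⊢
      simp only [e, if_neg h₁, if_pos h₂]
      rw [monomial_sum_one]
      refine Finset.prod_congr rfl fun j hj => ?_
      have := Finset.prod_ne_zero_iff.1 hi j hj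
      simp only [w₂, ne_eq, ite_eq_left_iff, not_forall] at this ⊢
      obtain ⟨h, -⟩ := this
      rw [if_neg h]; rfl
    · simp only [z, e, if_neg h₁, if_neg h₂]; rfl
  have h0 : ∀ i, z i = 0 → χ (X i) = 0 := by
    intro i hi
    have aux : ∀ {J : Finset (Fin n)} {d}, cellSupport o i ⊆ J → i d = o d →
        (∀ k, Ideal.Quotient.mk Q (fullMargin K (J.erase d) k) = 0) → χ (X i) = 0 :=
      fun {J d} hJ hd hL => by
        rw [hχ]
        refine map_fullMargin_eq_zero _ hL (fun j hj => Finset.mem_erase.2 ⟨?_, hJ hj⟩) i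
        rintro rfl
        exact (mem_cellSupport o).1 hj hd
    by_cases h₁ : cellSupport o i ⊆ J₁
    · rw [z₁ i h₁] at hi
      obtain ⟨j, hj, h⟩ := Finset.prod_eq_zero_iff.1 hi
      simp only [w₁, ite_eq_left_iff, X_ne_zero, imp_false, not_not] at h
      obtain ⟨rfl, h⟩ := h
      exact aux h₁ h hL₁
    by_cases h₂ : cellSupport o i ⊆ J₂
    · rw [z₂ i h₂] at hi
      obtain ⟨j, hj, h⟩ := Finset.prod_eq_zero_iff.1 hi
      simp only [w₂, ite_eq_left_iff, X_ne_zero, imp_false, not_not] at h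
      obtain ⟨rfl, h⟩ := h
      exact aux h₂ h hL₂
    · simp only [z, if_neg h₁, if_neg h₂] at hi
      exact absurd hi (X_ne_zero _)
  -- Three disjoint classes of cells using disjoint sets of variables, so the exponents of a
  -- monomial determine the marginals, or the cells themselves, class by class.
  let p₁ : ((j : Fin n) → Fin (a j)) → Prop := fun i => cellSupport o i ⊆ J₁
  let p₂ : ((j : Fin n) → Fin (a j)) → Prop := fun i => ¬ cellSupport o i ⊆ J₁ ∧ cellSupport o i ⊆ J₂
  let p₃ : ((j : Fin n) → Fin (a j)) → Prop := fun i =>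
    ¬ cellSupport o i ⊆ J₁ ∧ ¬ cellSupport o i ⊆ J₂
  have he₁ : ∀ j ∈ J₁, ∀ v i, e i (Sum.inl (Sum.inl ⟨j, v⟩)) = if p₁ i ∧ i j = v then 1 else 0 := by
    intro j hj v i
    by_cases h₁ : cellSupport o i ⊆ J₁
    · simp only [e, p₁, if_pos h₁, h₁, true_and]
      exact sum_single_apply (Sum.inl_injective.comp Sum.inl_injective) hj i v
    by_cases h₂ : cellSupport o i ⊆ J₂
    · simp only [e, p₁, if_neg h₁, if_pos h₂, h₁, false_and, if_false]
      exact sum_single_apply_of_ne J₂ _ fun k h => Sum.inr_ne_inl (Sum.inl_injective h)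
    · simp only [e, p₁, if_neg h₁, if_neg h₂, h₁, false_and, if_false]
      rw [Finsupp.single_apply, if_neg Sum.inr_ne_inl]
  have he₂ : ∀ j ∈ J₂, ∀ v i, e i (Sum.inl (Sum.inr ⟨j, v⟩)) = if p₂ i ∧ i j = v then 1 else 0 := by
    intro j hj v i
    by_cases h₁ : cellSupport o i ⊆ J₁
    · simp only [e, p₂, if_pos h₁, h₁, not_true_eq_false, false_and, if_false]
      exact sum_single_apply_of_ne J₁ _ fun k h => Sum.inl_ne_inr (Sum.inl_injective h)
    by_cases h₂ : cellSupport o i ⊆ J₂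
    · simp only [e, p₂, if_neg h₁, h₁, h₂, not_false_eq_true, true_and, if_true]
      exact sum_single_apply (Sum.inl_injective.comp Sum.inr_injective) hj i v
    · simp only [e, p₂, if_neg h₁, h₂, and_false, false_and, if_false]
      rw [Finsupp.single_apply, if_neg Sum.inr_ne_inl]
  have he₃ : ∀ k i, e i (Sum.inr k) = if p₃ i ∧ i = k then 1 else 0 := by
    intro k i
    by_cases h₁ : cellSupport o i ⊆ J₁
    · simp only [e, p₃, if_pos h₁, h₁, not_true_eq_false, false_and, if_false]
      exact sum_single_apply_of_ne J₁ _ fun k => Sum.inl_ne_inr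
    by_cases h₂ : cellSupport o i ⊆ J₂
    · simp only [e, p₃, if_neg h₁, h₂, if_true, not_true_eq_false, and_false, false_and, if_false]
      exact sum_single_apply_of_ne J₂ _ fun k => Sum.inl_ne_inr
    · simp only [e, p₃, if_neg h₁, h₁, h₂, if_false, not_false_eq_true, true_and]
      rw [Finsupp.single_apply]
      exact if_congr Sum.inr_injective.eq_iff rfl rfl
  have h1 : ∀ m m' : Multiset ((j : Fin n) → Fin (a j)), (m.map e).sum = (m'.map e).sum →
      (m.map fun i => χ (X i)).prod = (m'.map fun i => χ (X i)).prod := by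
    intro m m' h
    have split : ∀ m : Multiset ((j : Fin n) → Fin (a j)), (m.map fun i => χ (X i)).prod =
        ((m.filter p₁).map fun i => χ (X i)).prod * (((m.filter p₂).map fun i => χ (X i)).prod *
          ((m.filter p₃).map fun i => χ (X i)).prod) := fun m => by
      rw [← Multiset.prod_add, ← Multiset.map_add, ← Multiset.prod_add, ← Multiset.map_add]
      congr 2
      conv_lhs => rw [← Multiset.filter_add_not p₁ m,
        ← Multiset.filter_add_not (fun i => cellSupport o i ⊆ J₂) (m.filter fun i => ¬ p₁ i),
        Multiset.filter_filter, Multiset.filter_filter]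
      congr 2 <;> exact Multiset.filter_congr fun i _ => and_comm
    rw [split m, split m']
    congr 1
    · refine prod_eq_prod_of_cellSupport_subset o ⟨i₁, hi₁1⟩ hs₁
        (fun i hi => (Multiset.mem_filter.1 hi).2) (fun i hi => (Multiset.mem_filter.1 hi).2)
        fun j hj => Multiset.ext.2 fun v => ?_
      rw [← sum_map_apply_eq_count p₁ _ v e _ (he₁ j hj v), h,
        sum_map_apply_eq_count p₁ _ v e _ (he₁ j hj v)]
    congr 1
    · refine prod_eq_prod_of_cellSupport_subset o ⟨i₂, hi₂1⟩ hs₂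
        (fun i hi => (Multiset.mem_filter.1 hi).2.2) (fun i hi => (Multiset.mem_filter.1 hi).2.2)
        fun j hj => Multiset.ext.2 fun v => ?_
      rw [← sum_map_apply_eq_count p₂ _ v e _ (he₂ j hj v), h,
        sum_map_apply_eq_count p₂ _ v e _ (he₂ j hj v)]
    · have : m.filter p₃ = m'.filter p₃ := Multiset.ext.2 fun v => by
        have e3 := sum_map_apply_eq_count p₃ id v e _ (he₃ v)
        simp only [Multiset.map_id] at e3
        rw [← e3, h, e3]
      rw [this]
  have hQ : Q = RingHom.ker Φ := by
    refine hle.antisymm fun f hf => ?_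
    have := eq_zero_of_aeval_eq_zero z e hz χ h0 (fun m m' _ _ => h1 m m')
      (f := (coordEquiv K o).symm f) hf
    rw [← Ideal.Quotient.eq_zero_iff_mem]
    simpa [χ] using this
  rw [hQ]
  exact RingHom.ker_isPrime _

end MarginalIndependence

end

theorem mainTheorem8 {K : Type*} [Field K] {n : ℕ} (a : Fin n → ℕ) (ha : ∀ j, 1 ≤ a j)
    (Δ : Set (Finset (Fin n))) (hΔ : IsLowerSet Δ) (J₁ J₂ : Finset (Fin n)) (hJ : J₁ ≠ J₂)
    (hfacets : MarginalIndependence.facets Δ = {J₁, J₂}) :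
    (∀ i₁ ∈ J₁ \ J₂, ∀ i₂ ∈ J₂ \ J₁,
      (MarginalIndependence.twoFacetIdeal K a Δ J₁ J₂ i₁ i₂).IsPrime) ∧
    ((∀ j, 2 ≤ a j) → (J₁ ∩ J₂).Nonempty →
      (MarginalIndependence.independenceIdeal K a Δ).minimalPrimes =
        {MarginalIndependence.mainIdeal K a Δ} ∪
          {Q | ∃ i₁ ∈ J₁ \ J₂, ∃ i₂ ∈ J₂ \ J₁,
            Q = MarginalIndependence.twoFacetIdeal K a Δ J₁ J₂ i₁ i₂}) ∧
    (MarginalIndependence.independenceIdeal K a Δ).minimalPrimes =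
      {MarginalIndependence.mainIdeal K a Δ} ∪
        {Q | ∃ i₁ ∈ J₁ \ J₂, ∃ i₂ ∈ J₂ \ J₁,
          (2 ≤ a i₁ ∧ 2 ≤ a i₂ ∧ ∃ c ∈ J₁ ∩ J₂, 2 ≤ a c) ∧
          Q = MarginalIndependence.twoFacetIdeal K a Δ J₁ J₂ i₁ i₂} := by
  have hmem := MarginalIndependence.mem_iff_of_facets hΔ hfacets
  obtain ⟨hne₁, hne₂⟩ := MarginalIndependence.sdiff_nonempty_of_facets hJ hfacets
  have hQ : ∀ i₁ ∈ J₁ \ J₂, ∀ i₂ ∈ J₂ \ J₁,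
      (MarginalIndependence.twoFacetIdeal K a Δ J₁ J₂ i₁ i₂).IsPrime := fun i₁ h₁ i₂ h₂ =>
    MarginalIndependence.twoFacetIdeal_isPrime ha hmem h₁ h₂
  have hmin := MarginalIndependence.minimalPrimes_independenceIdeal (K := K) ha hmem hne₁ hne₂
    (MarginalIndependence.mainIdeal_isPrime ha hmem) hQ
  refine ⟨hQ, fun ha2 ⟨c, hc⟩ => ?_, hmin⟩
  rw [hmin]
  congr 1
  ext Q
  simp only [Set.mem_ofPred_eq]
  constructor
  · rintro ⟨i₁, h₁, i₂, h₂, -, h⟩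
    exact ⟨i₁, h₁, i₂, h₂, h⟩
  · rintro ⟨i₁, h₁, i₂, h₂, h⟩
    exact ⟨i₁, h₁, i₂, h₂, ⟨ha2 i₁, ha2 i₂, c, hc, ha2 c⟩, h⟩
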